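/- Let $\mathcal E$ be a Euclidean affine space with (finite-dimensional) translation vector space $\mathcal V$, and let $\varPi$ be a Bieberbach group in $\mathcal E$, that is, a torsion-free discrete subgroup of $\mathrm{Iso}\,\mathcal E$ having a compact fundamental domain (a compact set meeting every orbit). Let $L=\varPi\cap\mathcal V$ be its lattice subgroup (all the translations in $\varPi$) and $H\subseteq\mathrm{Iso}\,\mathcal V$ its holonomy group (the linear parts of all the elements of $\varPi$), so that there is a short exact sequence $L\to\varPi\to H$. Write $\mathrm{pr}:\mathcal E\to\mathcal M=\mathcal E/\varPi$ for the projection onto the corresponding compact flat Riemannian manifold. Let $\mathcal V'$ be a nonzero proper vector subspace of $\mathcal V$ which is $H$-invariant and is an $L$-subspace, meaning that it is spanned by $L\cap\mathcal V'$. Then the following holds. (i) The affine subspaces of $\mathcal E$ of dimension $\dim\mathcal V'$ parallel to $\mathcal V'$ (the cosets of $\mathcal V'$) are the leaves of a foliation $F_{\mathcal E}$ on $\mathcal E$. It is projectable, under the locally isometric covering projections $\mathrm{pr}:\mathcal E\to\mathcal M$ and $\mathcal E\to\mathcal T=\mathcal E/L$, onto foliations $F_{\mathcal M}$ of $\mathcal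 M$ and $F_{\mathcal T}$ of the torus $\mathcal T$; that is, the differentials of the projections map the tangent distribution of $F_{\mathcal E}$ onto those of $F_{\mathcal M}$ and $F_{\mathcal T}$. Both $F_{\mathcal M}$ and $F_{\mathcal T}$ have compact totally geodesic leaves, tangent to a parallel distribution. (ii) The leaves $\mathcal M'$ of $F_{\mathcal M}$ coincide with the $\mathrm{pr}$-images of the leaves $\mathcal E'$ of $F_{\mathcal E}$, and the restrictions $\mathrm{pr}:\mathcal E'\to\mathcal M'$ are (locally isometric) covering projections. The same is true with $\mathcal M$ and $\mathrm{pr}$ replaced by $\mathcal T$ and the projection $\mathcal E\to\mathcal T$. Given a leaf $\mathcal E'$ of $F_{\mathcal E}$ and the leaf $\mathcal M'=\mathrm{pr}(\mathcal E')$ of $F_{\mathcal M}$, there is a Bieberbach group $\varPi'$ in the Euclidean affine space $\mathcal E'$ corresponding to $\mathcal M'$, in the sense that $\mathrm{pr}:\mathcal E'\to\mathcal M'$ descends to an isometry $\mathcal E'/\varPi'\to\mathcal M'$. For any such $\varPi'$, with the lattice subgroup $L'$ and the holonomy group $H'$ of $\varPi'$, and with $\varSigma'$ denoting the stabilizer of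 $\mathcal E'$ in $\varPi$ (all the elements of $\varPi$ mapping $\mathcal E'$ onto itself): (a) $\varPi'$ consists of the restrictions to $\mathcal E'$ of all the elements of $\varSigma'$; (b) $H'$ is formed by the restrictions to $\mathcal V'$ of the linear parts of the elements of $\varSigma'$; (c) $L'=\varPi'\cap\mathcal V'$, and $L\cap\mathcal V'\subseteq L'$. (iii) The restriction homomorphism $\varSigma'\to\varPi'$ is an isomorphism. -/

import Mathlib

open Set Filter Topology MulAction Manifold
open scoped ContDiff Pointwise

/-! ## Isometries of a Euclidean affine space and Bieberbach groups

`P` is a Euclidean affine space (a metric torsor) over the finite-dimensional real inner product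
space `V`; its isometry group is the group `P ≃ᵃⁱ[ℝ] P` of affine isometries. -/

noncomputable section Groups

variable {V P : Type*} [NormedAddCommGroup V] [InnerProductSpace ℝ V]
  [MetricSpace P] [NormedAddTorsor V P]

/-- The tautological action of the isometry group. -/
instance isoMulAction : MulAction (P ≃ᵃⁱ[ℝ] P) P where
  smul g x := g x
  one_smul _ := rfl
  mul_smul _ _ _ := rfl

theorem iso_smul_def (g : P ≃ᵃⁱ[ℝ] P) (x : P) : g • x = g x := rfl

/-- The topology of the isometry group is that of pointwise convergence (for isometries it is the
same as the compact-open topology). -/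
instance isoTopology : TopologicalSpace (P ≃ᵃⁱ[ℝ] P) :=
  TopologicalSpace.induced (fun g : P ≃ᵃⁱ[ℝ] P => (g : P → P)) inferInstance

/-- Torsion-free discrete groups of isometries. -/
class IsTorsionFreeDiscrete (Γ : Subgroup (P ≃ᵃⁱ[ℝ] P)) : Prop where
  discrete : DiscreteTopology Γ
  torsionFree : ∀ γ ∈ Γ, IsOfFinOrder γ → γ = 1

/-- A Bieberbach group: a torsion-free discrete group of isometries which has a compact
fundamental domain, that is, a compact set meeting all the orbits. -/
class IsBieberbach (Γ : Subgroup (P ≃ᵃⁱ[ℝ] P)) : Prop extends IsTorsionFreeDiscrete Γ where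
  cocompact : ∃ K : Set P, IsCompact K ∧ ∀ x, ∃ γ ∈ Γ, γ x ∈ K

/-- The linear-part homomorphism. -/
def linearPart : (P ≃ᵃⁱ[ℝ] P) →* (V ≃ₗᵢ[ℝ] V) where
  toFun g := g.linearIsometryEquiv
  map_one' := rfl
  map_mul' _ _ := rfl

/-- The lattice subgroup `L = Π ∩ V`: all the vectors whose translation lies in `Π`. -/
def latticeSubgroup (Γ : Subgroup (P ≃ᵃⁱ[ℝ] P)) : AddSubgroup V where
  carrier := {v | AffineIsometryEquiv.constVAdd ℝ P v ∈ Γ}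
  zero_mem' := by
    have h : AffineIsometryEquiv.constVAdd ℝ P (0 : V) = 1 := AffineIsometryEquiv.constVAdd_zero
    simp only [mem_ofPred_eq, h, one_mem]
  add_mem' {v w} hv hw := by
    have h : AffineIsometryEquiv.constVAdd ℝ P (v + w)
        = AffineIsometryEquiv.constVAdd ℝ P v * AffineIsometryEquiv.constVAdd ℝ P w := by
      ext x; simp [add_vadd]
    simp only [mem_ofPred_eq, h]
    exact mul_mem hv hw
  neg_mem' {v} hv := by
    have h : AffineIsometryEquiv.constVAdd ℝ P (-v)
        = (AffineIsometryEquiv.constVAdd ℝ P v)⁻¹ := by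
      rw [eq_inv_iff_mul_eq_one]
      ext x; simp
    simp only [mem_ofPred_eq, h]
    exact inv_mem hv

/-- The same lattice `L`, as a subgroup of the isometry group: all the translations in `Π`. -/
def translationSubgroup (Γ : Subgroup (P ≃ᵃⁱ[ℝ] P)) : Subgroup (P ≃ᵃⁱ[ℝ] P) where
  carrier := {g | ∃ v ∈ latticeSubgroup Γ, g = AffineIsometryEquiv.constVAdd ℝ P v}
  one_mem' := ⟨0, zero_mem _, by ext x; simp⟩
  mul_mem' := by
    rintro _ _ ⟨v, hv, rfl⟩ ⟨w, hw, rfl⟩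
    exact ⟨v + w, add_mem hv hw, by ext x; simp [add_vadd]⟩
  inv_mem' := by
    rintro _ ⟨v, hv, rfl⟩
    refine ⟨-v, neg_mem hv, ?_⟩
    rw [inv_eq_iff_mul_eq_one]
    ext x; simp

theorem translationSubgroup_le (Γ : Subgroup (P ≃ᵃⁱ[ℝ] P)) : translationSubgroup Γ ≤ Γ := by
  rintro _ ⟨v, hv, rfl⟩
  exact hv

/-- The holonomy group: the linear parts of all the elements of `Π`. -/
def holonomyGroup (Γ : Subgroup (P ≃ᵃⁱ[ℝ] P)) : Subgroup (V ≃ₗᵢ[ℝ] V) :=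
  Γ.map linearPart

/-- Invariance of a vector subspace under a group of linear isometries. -/
def IsInvariantSubspace (H : Subgroup (V ≃ₗᵢ[ℝ] V)) (W : Submodule ℝ V) : Prop :=
  ∀ A ∈ H, ∀ v ∈ W, A v ∈ W

/-- An `L`-subspace: a vector subspace `W` spanned by `L ∩ W`. -/
def IsLatticeSubspace (L : AddSubgroup V) (W : Submodule ℝ V) : Prop :=
  Submodule.span ℝ ((L : Set V) ∩ W) = W

/-- The stabilizer in `Π` of a subset of the affine space: all the elements of `Π` mapping it onto
itself. -/
def stabilizerIn (Γ : Subgroup (P ≃ᵃⁱ[ℝ] P)) (S : Set P) : Subgroup (P ≃ᵃⁱ[ℝ] P) where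
  carrier := {γ | γ ∈ Γ ∧ γ '' S = S}
  one_mem' := ⟨one_mem _, by simp⟩
  mul_mem' := by
    rintro a b ⟨ha, ha'⟩ ⟨hb, hb'⟩
    exact ⟨mul_mem ha hb, by rw [AffineIsometryEquiv.coe_mul, image_comp, hb', ha']⟩
  inv_mem' := by
    rintro a ⟨ha, ha'⟩
    refine ⟨inv_mem ha, ?_⟩
    conv_lhs => rw [← ha']
    rw [← image_comp, ← AffineIsometryEquiv.coe_mul, inv_mul_cancel]
    simp

instance (Γ : Subgroup (P ≃ᵃⁱ[ℝ] P)) : ContinuousConstSMul Γ P :=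
  ⟨fun γ => (γ : P ≃ᵃⁱ[ℝ] P).continuous⟩

theorem IsTorsionFreeDiscrete.mono {Γ Γ' : Subgroup (P ≃ᵃⁱ[ℝ] P)} (h : IsTorsionFreeDiscrete Γ)
    (hle : Γ' ≤ Γ) : IsTorsionFreeDiscrete Γ' where
  discrete := by
    have := h.discrete
    exact DiscreteTopology.of_subset (s := (Γ : Set (P ≃ᵃⁱ[ℝ] P))) this hle
  torsionFree γ hγ := h.torsionFree γ (hle hγ)

instance (Γ : Subgroup (P ≃ᵃⁱ[ℝ] P)) [h : IsTorsionFreeDiscrete Γ] :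
    IsTorsionFreeDiscrete (translationSubgroup Γ) :=
  h.mono (translationSubgroup_le Γ)

/-- A discrete group of isometries is separated from the identity on some finite set. -/
theorem exists_finset_of_discrete (Γ : Subgroup (P ≃ᵃⁱ[ℝ] P)) (h : DiscreteTopology Γ) :
    ∃ F : Finset P, ∃ ε > 0, ∀ γ ∈ Γ, (∀ x ∈ F, dist (γ x) x < ε) → γ = 1 := by
  have h1 : ({1} : Set Γ) ∈ 𝓝 (1 : Γ) := by
    rw [nhds_discrete]; exact mem_pure.2 rfl
  rw [nhds_induced, mem_comap] at h1
  obtain ⟨t, ht, hts⟩ := h1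
  rw [nhds_induced, mem_comap] at ht
  obtain ⟨u, hu, hut⟩ := ht
  rw [nhds_pi, mem_pi'] at hu
  obtain ⟨F, r, hr, hru⟩ := hu
  have hr' : ∀ x : P, ∃ ε > 0, Metric.ball x ε ⊆ r x := fun x => by
    have := hr x
    exact Metric.mem_nhds_iff.1 this
  choose ε hε hεr using hr'
  obtain ⟨δ, hδ, hδF⟩ : ∃ δ > 0, ∀ x ∈ F, δ ≤ ε x := by
    rcases F.eq_empty_or_nonempty with rfl | hF
    · exact ⟨1, one_pos, by simp⟩
    · obtain ⟨x, hx, hmin⟩ := F.exists_min_image ε hF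
      exact ⟨ε x, hε x, hmin⟩
  refine ⟨F, δ, hδ, fun γ hγ hF => ?_⟩
  have : (⟨γ, hγ⟩ : Γ) ∈ ({1} : Set Γ) := by
    refine hts (hut (hru ?_))
    intro x hx
    exact hεr x ((hF x hx).trans_le (hδF x hx))
  exact congrArg Subtype.val (mem_singleton_iff.1 this)

variable [FiniteDimensional ℝ V]

instance (priority := low) affineProperSpace : ProperSpace P := by
  have o : P := Classical.arbitrary P
  refine ⟨fun x r => ?_⟩
  have : ProperSpace V := FiniteDimensional.proper ℝ V
  have h := (isCompact_closedBall (o -ᵥ o : V) (dist x o + r)).image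
    (Homeomorph.vaddConst o).continuous
  refine h.of_isClosed_subset Metric.isClosed_closedBall ?_
  intro y hy
  refine ⟨y -ᵥ o, ?_, by simp⟩
  simp only [Metric.mem_closedBall, vsub_self, dist_zero_right] at hy ⊢
  rw [← dist_eq_norm_vsub]
  linarith [dist_triangle y x o]

instance (Γ : Subgroup (P ≃ᵃⁱ[ℝ] P)) [h : IsTorsionFreeDiscrete Γ] :
    ProperlyDiscontinuousSMul Γ P := by
  obtain ⟨F, ε, hε, hF⟩ := exists_finset_of_discrete Γ h.discrete
  refine ⟨fun {K L} hK hL => ?_⟩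
  by_contra hinf
  set A : Set Γ := {γ : Γ | ((γ • ·) '' K ∩ L).Nonempty} with hA
  have hinf' : A.Infinite := hinf
  obtain ⟨γ₀, hγ₀⟩ := hinf'.nonempty
  obtain ⟨_, ⟨k₀, hk₀, _⟩, hl₀⟩ := hγ₀
  obtain ⟨RK, hRK⟩ := hK.isBounded.subset_closedBall k₀
  obtain ⟨RL, hRL⟩ := hL.isBounded.subset_closedBall k₀
  let Φ : Γ → (F → P) := fun γ x => (γ : P ≃ᵃⁱ[ℝ] P) x
  have key : ∀ γ γ' : Γ, (∀ x : F, dist (Φ γ x) (Φ γ' x) < ε) → γ = γ' := by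
    intro γ γ' hd
    have h1 : ((γ'⁻¹ * γ : Γ) : P ≃ᵃⁱ[ℝ] P) = 1 := by
      refine hF _ (γ'⁻¹ * γ : Γ).2 fun x hx => ?_
      have h2 := hd ⟨x, hx⟩
      have h3 : dist (((γ'⁻¹ * γ : Γ) : P ≃ᵃⁱ[ℝ] P) x) x
          = dist ((γ : P ≃ᵃⁱ[ℝ] P) x) ((γ' : P ≃ᵃⁱ[ℝ] P) x) := by
        rw [← (γ' : P ≃ᵃⁱ[ℝ] P).dist_map]
        simp
      rw [h3]; exact h2
    have h2 : γ'⁻¹ * γ = 1 := Subtype.ext h1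
    exact (inv_mul_eq_one.1 h2).symm
  have hinj : Function.Injective Φ := fun γ γ' he => key γ γ' fun x => by
    rw [he, dist_self]; exact hε
  have hcomp : IsCompact (Set.pi univ fun x : F => Metric.closedBall k₀ (RL + (RK + dist k₀ x))) :=
    isCompact_univ_pi fun x => isCompact_closedBall _ _
  have hsub : Φ '' A ⊆ Set.pi univ fun x : F => Metric.closedBall k₀ (RL + (RK + dist k₀ x)) := by
    rintro _ ⟨γ, ⟨_, ⟨k, hk, rfl⟩, hl⟩, rfl⟩ x -
    have h1 : dist ((γ : P ≃ᵃⁱ[ℝ] P) k) k₀ ≤ RL := hRL hl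
    have h2 : dist k k₀ ≤ RK := hRK hk
    have h3 : dist ((γ : P ≃ᵃⁱ[ℝ] P) x) ((γ : P ≃ᵃⁱ[ℝ] P) k) = dist (x : P) k :=
      (γ : P ≃ᵃⁱ[ℝ] P).dist_map _ _
    have h4 := dist_triangle ((γ : P ≃ᵃⁱ[ℝ] P) x) ((γ : P ≃ᵃⁱ[ℝ] P) k) k₀
    have h5 := dist_triangle (x : P) k₀ k
    rw [dist_comm k₀ k, dist_comm (x : P) k₀] at h5
    change dist ((γ : P ≃ᵃⁱ[ℝ] P) x) k₀ ≤ _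
    linarith
  obtain ⟨z, -, hz⟩ := (hinf'.image hinj.injOn).exists_accPt_of_subset_isCompact hcomp hsub
  rw [accPt_iff_frequently] at hz
  have hb : Metric.ball z (ε / 2) ∈ 𝓝 z := Metric.ball_mem_nhds _ (by linarith)
  obtain ⟨y, ⟨hyz, γ, hγ, rfl⟩, hy⟩ := (hz.and_eventually hb).exists
  have hb' : Metric.ball z (min (ε / 2) (dist (Φ γ) z)) ∈ 𝓝 z :=
    Metric.ball_mem_nhds _ (lt_min (by linarith) (dist_pos.2 hyz))
  obtain ⟨y', ⟨-, γ', hγ', rfl⟩, hy'⟩ := (hz.and_eventually hb').exists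
  have hy1 : dist (Φ γ) z < ε / 2 := hy
  have hy2 : dist (Φ γ') z < min (ε / 2) (dist (Φ γ) z) := hy'
  have : γ = γ' := key γ γ' fun x => by
    have h1 := dist_le_pi_dist (Φ γ) (Φ γ') x
    have h2 := dist_triangle_right (Φ γ) (Φ γ') z
    have h3 := hy2.trans_le (min_le_left _ _)
    linarith
  subst this
  exact lt_irrefl _ (hy2.trans_le (min_le_right _ _))

instance (Γ : Subgroup (P ≃ᵃⁱ[ℝ] P)) [h : IsTorsionFreeDiscrete Γ] : IsCancelSMul Γ P := by
  rw [isCancelSMul_iff_eq_one_of_smul_eq]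
  intro γ x hx
  have hfin := ProperlyDiscontinuousSMul.finite_disjoint_inter_image (Γ := Γ)
    (isCompact_singleton (x := x)) (isCompact_singleton (x := x))
  have hpow : ∀ n : ℕ, γ ^ n • x = x := fun n => by
    induction n with
    | zero => simp
    | succ n ih => rw [pow_succ, mul_smul, hx, ih]
  have hγ : IsOfFinOrder γ := by
    by_contra hno
    have hinj := injective_pow_iff_not_isOfFinOrder.2 hno
    refine Set.infinite_range_of_injective hinj (hfin.subset ?_)
    rintro _ ⟨n, rfl⟩
    exact ⟨x, ⟨x, rfl, hpow n⟩, rfl⟩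
  exact Subtype.ext (h.torsionFree γ γ.2 (Submonoid.isOfFinOrder_coe.2 hγ))

end Groups

/-! ## Flat Riemannian manifolds

A flat Riemannian manifold is a manifold with an atlas whose transition maps are locally
restrictions of Euclidean isometries; the Riemannian metric is the one for which the charts are
isometric, and its Levi-Civita connection is ordinary differentiation in these charts. -/

noncomputable section Flat

variable {V : Type*} [NormedAddCommGroup V] [InnerProductSpace ℝ V]

variable (V) in
/-- The pregroupoid of maps which near every point agree with a Euclidean isometry. -/
def euclideanPregroupoid : Pregroupoid V where
  property f u := ∀ x ∈ u, ∃ g : V ≃ᵃⁱ[ℝ] V, f =ᶠ[𝓝 x] g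
  comp {f g u v} hf hg _ _ _ x hx := by
    obtain ⟨a, ha⟩ := hf x hx.1
    obtain ⟨b, hb⟩ := hg (f x) hx.2
    refine ⟨b * a, ?_⟩
    have hc : Tendsto f (𝓝 x) (𝓝 (f x)) := by
      have h1 : Tendsto a (𝓝 x) (𝓝 (a x)) := a.continuous.continuousAt
      rw [ha.eq_of_nhds]
      exact h1.congr' ha.symm
    filter_upwards [ha, hc.eventually hb] with y hy1 hy2
    rw [Function.comp_apply, hy2, hy1]; rfl
  id_mem x _ := ⟨1, EventuallyEq.rfl⟩
  locality {f u} hu h x hx := by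
    obtain ⟨v, hv, hxv, h'⟩ := h x hx
    exact h' x ⟨hx, hxv⟩
  congr {f g u} hu hfg hf x hx := by
    obtain ⟨a, ha⟩ := hf x hx
    refine ⟨a, ?_⟩
    filter_upwards [ha, hu.mem_nhds hx] with y hy1 hy2
    rw [hfg y hy2, hy1]

variable (V) in
/-- The groupoid of local Euclidean isometries of `V`. -/
def euclideanGroupoid : StructureGroupoid V :=
  (euclideanPregroupoid V).groupoid

instance : ClosedUnderRestriction (euclideanGroupoid V) := by
  refine (closedUnderRestriction_iff_id_le _).2 (StructureGroupoid.le_iff.2 ?_)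
  rintro e ⟨s, hs, hes⟩
  refine (euclideanGroupoid V).mem_of_eqOnSource ?_ hes
  exact ⟨fun x _ => ⟨1, EventuallyEq.rfl⟩, fun x _ => ⟨1, EventuallyEq.rfl⟩⟩

variable (V) in
/-- The isometric charts of a flat Riemannian manifold. -/
def flatCharts (M : Type*) [TopologicalSpace M] [ChartedSpace V M] :
    Set (OpenPartialHomeomorph M V) :=
  (euclideanGroupoid V).maximalAtlas M

/-- The Riemannian metric of a flat Riemannian manifold. The tangent space at `x` is `V`, by means
of the isometric chart `chartAt V x`, and the inner product is that of `V`. -/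
def flatInner {M : Type*} [TopologicalSpace M] [ChartedSpace V M] {x : M}
    (v w : TangentSpace 𝓘(ℝ, V) x) : ℝ :=
  inner ℝ (show V from v) (show V from w)

variable {P : Type*} [MetricSpace P] [NormedAddTorsor V P]

/-- A Euclidean affine space as a flat manifold, with the single chart `x ↦ x - o`, where `o` is an
arbitrary origin. Thus all its tangent spaces are `V`. -/
instance (priority := 50) affineChartedSpace : ChartedSpace V P :=
  (Homeomorph.vaddConst (Classical.arbitrary P)).symm.toOpenPartialHomeomorph.singletonChartedSpace
    rfl

instance (priority := 50) affineHasGroupoid : HasGroupoid P (euclideanGroupoid V) :=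
  OpenPartialHomeomorph.singleton_hasGroupoid _ rfl _

variable [FiniteDimensional ℝ V]

/-- The flat manifold `E / Γ`: its charts are the local inverses of the projection, followed by the
chart of `E`; their transition maps are restrictions of elements of `Γ`. -/
instance quotientHasGroupoid (Γ : Subgroup (P ≃ᵃⁱ[ℝ] P)) [IsTorsionFreeDiscrete Γ] :
    HasGroupoid (orbitRel.Quotient Γ P) (euclideanGroupoid V) := by
  refine hasGroupoid_of_pregroupoid _ ?_
  rintro _ _ ⟨p, rfl⟩ ⟨q, rfl⟩ y hy
  generalize_proofs hl hr at hy ⊢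
  set a := hr.choose p
  set b := hr.choose q
  set o : P := Classical.arbitrary P
  set x₀ : P := y +ᵥ o
  have hx₀ : Quotient.mk (orbitRel Γ P) x₀ ∈ (hl.localInverseAt b).source := by
    have h := hy.2
    simp only [OpenPartialHomeomorph.trans_source, mem_preimage, mem_inter_iff] at h
    convert! h.1 using 1
    simp [OpenPartialHomeomorph.trans_symm_eq_symm_trans_symm]
    rfl
  set c : P := hl.localInverseAt b (Quotient.mk (orbitRel Γ P) x₀) with hc
  have hmk : Quotient.mk (orbitRel Γ P) c = Quotient.mk (orbitRel Γ P) x₀ :=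
    hl.apply_localInverseAt_of_mem hx₀
  obtain ⟨γ, hγ⟩ : c ∈ orbit Γ x₀ := Quotient.exact hmk
  have hγ' : (γ : P ≃ᵃⁱ[ℝ] P) x₀ = c := hγ
  refine ⟨((AffineIsometryEquiv.vaddConst ℝ o).trans (γ : P ≃ᵃⁱ[ℝ] P)).trans
    (AffineIsometryEquiv.vaddConst ℝ o).symm, ?_⟩
  have hcont : Continuous fun z : V => (γ : P ≃ᵃⁱ[ℝ] P) (z +ᵥ o) :=
    (γ : P ≃ᵃⁱ[ℝ] P).continuous.comp (Homeomorph.vaddConst o).continuous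
  have hev : ∀ᶠ z in 𝓝 y, (γ : P ≃ᵃⁱ[ℝ] P) (z +ᵥ o) ∈ (hl.localInverseAt b).target := by
    refine hcont.continuousAt.eventually ((hl.localInverseAt b).open_target.mem_nhds ?_)
    change (γ : P ≃ᵃⁱ[ℝ] P) x₀ ∈ _
    rw [hγ']
    exact (hl.localInverseAt b).map_source hx₀
  filter_upwards [hev] with z hz
  have h1 : Quotient.mk (orbitRel Γ P) ((γ : P ≃ᵃⁱ[ℝ] P) (z +ᵥ o))
      = Quotient.mk (orbitRel Γ P) (z +ᵥ o) :=
    Quotient.sound ⟨γ, rfl⟩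
  have h2 : hl.localInverseAt b (Quotient.mk (orbitRel Γ P) (z +ᵥ o))
      = (γ : P ≃ᵃⁱ[ℝ] P) (z +ᵥ o) := by
    rw [← h1]
    have := (hl.localInverseAt b).right_inv hz
    rwa [hl.localInverseAt_symm] at this
  have h3 : ∀ w : P, (chartAt V w : P → V) = fun x => x -ᵥ o := fun _ => rfl
  have h4 : ∀ w : P, ((chartAt V w).symm : V → P) = fun v => v +ᵥ o := fun _ => rfl
  simp only [OpenPartialHomeomorph.coe_trans, OpenPartialHomeomorph.trans_symm_eq_symm_trans_symm,
    Function.comp_apply, IsLocalHomeomorph.localInverseAt_symm, h3, h4]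
  rw [h2]
  rfl

/-- The local isometries of `V` are smooth, so that flat manifolds are smooth manifolds. -/
instance quotientIsManifold (Γ : Subgroup (P ≃ᵃⁱ[ℝ] P)) [IsTorsionFreeDiscrete Γ] :
    IsManifold 𝓘(ℝ, V) ∞ (orbitRel.Quotient Γ P) := by
  have key : ∀ (f : V → V) (s : Set V), (∀ x ∈ s, ∃ g : V ≃ᵃⁱ[ℝ] V, f =ᶠ[𝓝 x] g) →
      ContDiffOn ℝ ∞ f s := by
    intro f s h x hx
    obtain ⟨g, hg⟩ := h x hx
    have h1 : (g : V → V) = fun y => g.linearIsometryEquiv y + g 0 := by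
      funext y
      have := g.map_vadd 0 y
      simpa using this
    have h2 : ContDiff ℝ ∞ g := by
      rw [h1]
      exact g.linearIsometryEquiv.contDiff.add contDiff_const
    exact (h2.contDiffAt.congr_of_eventuallyEq hg).contDiffWithinAt
  refine isManifold_of_contDiffOn _ _ _ fun e e' he he' => ?_
  have h := (euclideanGroupoid V).compatible he he'
  simpa using key _ _ h.1

end Flat

/-! ## Distributions, submanifolds and leaves in flat Riemannian manifolds -/

noncomputable section Foliations

universe u v

variable {V : Type v} [NormedAddCommGroup V] [InnerProductSpace ℝ V]
  {M : Type u} [TopologicalSpace M] [ChartedSpace V M]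

variable (V M) in
/-- A field of tangent subspaces. The smooth ones of constant rank are the distributions; those
below are parallel, which includes smoothness. -/
abbrev TangentField := ∀ x : M, Submodule ℝ (TangentSpace 𝓘(ℝ, V) x)

/-- The differential at `x` of the chart `e`. -/
def chartDeriv (e : OpenPartialHomeomorph M V) (x : M) : TangentSpace 𝓘(ℝ, V) x →L[ℝ] V :=
  mfderiv 𝓘(ℝ, V) 𝓘(ℝ, V) e x

/-- The image of `D x` under the differential of the chart `e`. -/
def TangentField.inChart (D : TangentField V M) (e : OpenPartialHomeomorph M V) (x : M) :
    Submodule ℝ V :=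
  (D x).map (chartDeriv e x : TangentSpace 𝓘(ℝ, V) x →ₗ[ℝ] V)

/-- `D` is a parallel distribution (for the Levi-Civita connection): in every isometric chart, in
which covariant differentiation is ordinary differentiation, it is locally constant. -/
def TangentField.IsParallel (D : TangentField V M) : Prop :=
  ∀ e ∈ flatCharts V M, ∀ x ∈ e.source, ∀ᶠ y in 𝓝 x, D.inChart e y = D.inChart e x

/-- `D` is projectable under `f` onto `D'`: the differential of `f` at `x` maps `D x` onto
`D' (f x)`, for all `x`. -/
def TangentField.IsProjectable {M' : Type*} [TopologicalSpace M'] [ChartedSpace V M']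
    (D : TangentField V M) (f : M → M') (D' : TangentField V M') : Prop :=
  ∀ x, (D x).map (mfderiv 𝓘(ℝ, V) 𝓘(ℝ, V) f x :
    TangentSpace 𝓘(ℝ, V) x →ₗ[ℝ] TangentSpace 𝓘(ℝ, V) (f x)) = D' (f x)

variable (V M) in
/-- A submanifold (not necessarily carrying the subset topology): a smooth second countable
manifold with an injective immersion into `M`. -/
structure Submanifold where
  Pts : Type u
  dim : ℕ
  [top : TopologicalSpace Pts]
  [secondCountable : SecondCountableTopology Pts]
  [charted : ChartedSpace (EuclideanSpace ℝ (Fin dim)) Pts]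
  [smooth : IsManifold (𝓡 dim) ∞ Pts]
  incl : Pts → M
  incl_injective : Function.Injective incl
  incl_immersion : IsImmersion (𝓡 dim) 𝓘(ℝ, V) ∞ incl

attribute [instance] Submanifold.top Submanifold.secondCountable Submanifold.charted
  Submanifold.smooth

namespace Submanifold

variable (N : Submanifold V M)

/-- The differential of the inclusion. -/
def dincl (p : N.Pts) :
    TangentSpace (𝓡 N.dim) p →L[ℝ] TangentSpace 𝓘(ℝ, V) (N.incl p) :=
  mfderiv (𝓡 N.dim) 𝓘(ℝ, V) N.incl p

/-- The tangent space of the submanifold, as a subspace of that of `M`. -/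
def tangent (p : N.Pts) : Submodule ℝ (TangentSpace 𝓘(ℝ, V) (N.incl p)) :=
  LinearMap.range (N.dincl p : TangentSpace (𝓡 N.dim) p →ₗ[ℝ] TangentSpace 𝓘(ℝ, V) (N.incl p))

/-- The submanifold metric. -/
def metric {p : N.Pts} (a b : TangentSpace (𝓡 N.dim) p) : ℝ :=
  flatInner (N.dincl p a) (N.dincl p b)

/-- An integral manifold of `D`. -/
def IsIntegral (D : TangentField V M) : Prop :=
  ∀ p, N.tangent p = D (N.incl p)

/-- A leaf of `D`: a maximal connected integral manifold. -/
def IsLeaf (D : TangentField V M) : Prop :=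
  ConnectedSpace N.Pts ∧ N.IsIntegral D ∧
    ∀ N' : Submanifold V M, ConnectedSpace N'.Pts → N'.IsIntegral D →
      range N.incl ⊆ range N'.incl → range N'.incl = range N.incl

/-- Total geodesicity: every geodesic of `M` issuing from a point of `N` in a direction tangent to
`N` (in an isometric chart `e`, a straight line `t ↦ e p + t • a`) is near the initial point a
curve in `N`. -/
def IsTotallyGeodesic : Prop :=
  ∀ p : N.Pts, ∀ e ∈ flatCharts V M, N.incl p ∈ e.source →
    ∀ a ∈ (N.tangent p).map (chartDeriv e (N.incl p) : TangentSpace 𝓘(ℝ, V) (N.incl p) →ₗ[ℝ] V),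
    ∃ c : ℝ → N.Pts, c 0 = p ∧
      ∀ᶠ t in 𝓝 (0 : ℝ), ContinuousAt c t ∧ N.incl (c t) = e.symm (e (N.incl p) + t • a)

end Submanifold

/-- The leaves of `D`, as subsets of `M`. -/
def leafSets (D : TangentField V M) : Set (Set M) :=
  {S | ∃ N : Submanifold V M, N.IsLeaf D ∧ range N.incl = S}

/-- The leaves of `D` form a foliation: they are a partition of `M` into integral manifolds. -/
def IsFoliation (D : TangentField V M) : Prop :=
  ∀ x : M, ∃! S, S ∈ leafSets D ∧ x ∈ S

/-- A Riemannian covering projection: a smooth covering projection which is locally isometric. -/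
def IsRiemannianCovering {M' : Type*} [TopologicalSpace M'] [ChartedSpace V M']
    (f : M → M') : Prop :=
  IsCoveringMap f ∧ Function.Surjective f ∧ IsLocalDiffeomorph 𝓘(ℝ, V) 𝓘(ℝ, V) ∞ f ∧
    ∀ (x : M) (a b : TangentSpace 𝓘(ℝ, V) x),
      flatInner (mfderiv 𝓘(ℝ, V) 𝓘(ℝ, V) f x a) (mfderiv 𝓘(ℝ, V) 𝓘(ℝ, V) f x b) = flatInner a b

/-- The same for a mapping of a flat manifold `X` onto a submanifold of `M`. -/
def IsRiemannianCoveringOnto {W X : Type*} [NormedAddCommGroup W] [InnerProductSpace ℝ W]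
    [TopologicalSpace X] [ChartedSpace W X] (N : Submanifold V M) (f : X → N.Pts) : Prop :=
  IsCoveringMap f ∧ Function.Surjective f ∧ IsLocalDiffeomorph 𝓘(ℝ, W) (𝓡 N.dim) ∞ f ∧
    ∀ (x : X) (a b : TangentSpace 𝓘(ℝ, W) x),
      N.metric (mfderiv 𝓘(ℝ, W) (𝓡 N.dim) f x a) (mfderiv 𝓘(ℝ, W) (𝓡 N.dim) f x b)
        = flatInner a b

/-- An isometry (isometric diffeomorphism) between a flat manifold `X` and a submanifold of `M`. -/
def IsRiemannianIsometry {W X : Type*} [NormedAddCommGroup W] [InnerProductSpace ℝ W]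
    [TopologicalSpace X] [ChartedSpace W X] (N : Submanifold V M) (f : X → N.Pts) : Prop :=
  IsRiemannianCoveringOnto (W := W) N f ∧ Function.Injective f

end Foliations

noncomputable section Quotients

universe u v

variable {V : Type v} {P : Type u} [NormedAddCommGroup V] [InnerProductSpace ℝ V]
  [MetricSpace P] [NormedAddTorsor V P]

/-- The quotient `E / Γ`. -/
abbrev QuotientSpace (Γ : Subgroup (P ≃ᵃⁱ[ℝ] P)) : Type u := orbitRel.Quotient Γ P

/-- The projection `E → E / Γ`. -/
def quotientMap (Γ : Subgroup (P ≃ᵃⁱ[ℝ] P)) (x : P) : QuotientSpace Γ :=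
  Quotient.mk (orbitRel Γ P) x

variable (P) in
/-- The parallel distribution on the affine space `E` tangent to a vector subspace. -/
def constField (W : Submodule ℝ V) : TangentField V P := fun _ => W

/-- The affine subspaces of `E` parallel to `W`, of the same dimension (the cosets of `W`). -/
def IsCoset (W : Submodule ℝ V) (E' : AffineSubspace ℝ P) : Prop :=
  (E' : Set P).Nonempty ∧ E'.direction = W

variable [FiniteDimensional ℝ V]

/-- `Γ'`, a Bieberbach group in the affine subspace `E'`, corresponds to the submanifold `N` of
`E / Γ`: the restriction to `E'` of the projection `E → E / Γ` descends to an isometry between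
`E' / Γ'` and `N`. -/
def CorrespondsTo {Γ : Subgroup (P ≃ᵃⁱ[ℝ] P)} [IsTorsionFreeDiscrete Γ]
    (N : Submanifold V (QuotientSpace Γ)) (E' : AffineSubspace ℝ P) [Nonempty E']
    (Γ' : Subgroup (E' ≃ᵃⁱ[ℝ] E')) : Prop :=
  ∃ _ : IsBieberbach Γ', ∃ φ : QuotientSpace Γ' → N.Pts,
    IsRiemannianIsometry (W := E'.direction) N φ ∧
      ∀ x : E', N.incl (φ (quotientMap Γ' x)) = quotientMap Γ (x : P)

end Quotients

universe u v

/-! ## Affine spaces as manifolds -/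

section AffineManifold

variable {V P : Type*} [NormedAddCommGroup V] [InnerProductSpace ℝ V]
  [MetricSpace P] [NormedAddTorsor V P]

/-! The space `E`, the torus `E / L` and `M = E / Γ` are treated at once through `IsFlatProjection`:
a projection `pr` whose fibres are the orbits of a group of isometries and whose preferred charts
pull back to elements of that group. The trivial group gives `E` itself.

In preferred charts the differential of `pr` is the linear part of a group element. An invariant `W`
is mapped onto itself by these linear parts, so the constant field `W` descends
(`IsFlatProjection.isProjectable`). Every isometric chart pulls back to a Euclidean isometry `G`, in
which the field is the constant subspace `G(W)`; hence it is parallel.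

Invariance also makes any group element that moves one point of a coset `E'` into a parallel coset
map the whole of `E'` onto that coset. Thus the images `pr(E')` are equal or disjoint, and the
fibres of `pr` on `E'` are the orbits of the restricted stabilizer (`lift_apply_eq_iff`). The
quotient of `E'` by this group is an integral manifold with image `pr(E')` (`exists_submanifold`).
Conversely, an integral manifold lifts locally to a map into `E` with differentials onto `W`, so it
is locally an open piece of some `pr(E')` (`exists_partialDiffeomorph`), and by connectedness it
stays in one such image (`range_incl_subset`). So the leaves are exactly the sets `pr(E')`.

Since `L ∩ W` spans `W`, a basis of lattice vectors gives a compact fundamental domain in each `E'`;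
this makes the leaves compact and the restricted group cocompact. A corresponding group has the same
orbits in `E'` as the restricted one, and discrete torsion-free groups with equal orbits coincide
(`le_of_orbits_subset`). This identifies `Γ'`, and restriction is injective because `Γ` acts freely.
-/

instance affineIsManifold : IsManifold 𝓘(ℝ, V) ∞ P :=
  OpenPartialHomeomorph.isManifold_singleton _ rfl

theorem contMDiff_vsub_const (x : P) :
    ContMDiff 𝓘(ℝ, V) 𝓘(ℝ, V) ∞ (fun y : P => y -ᵥ x) := by
  have h1 : ContMDiff 𝓘(ℝ, V) 𝓘(ℝ, V) ∞ (chartAt V x) :=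
    contMDiffOn_univ.1 (contMDiffOn_chart (I := 𝓘(ℝ, V)) (n := ∞) (x := x))
  have h2 : ContMDiff 𝓘(ℝ, V) 𝓘(ℝ, V) ∞
      (fun v : V => v + ((Classical.arbitrary P : P) -ᵥ x)) :=
    (contDiff_id.add contDiff_const).contMDiff
  convert! h2.comp h1 using 1
  ext y
  simp

theorem contMDiff_vadd_const (x : P) :
    ContMDiff 𝓘(ℝ, V) 𝓘(ℝ, V) ∞ (fun v : V => v +ᵥ x) := by
  have h1 : ContMDiff 𝓘(ℝ, V) 𝓘(ℝ, V) ∞ (chartAt V x).symm :=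
    contMDiffOn_univ.1 (contMDiffOn_chart_symm (I := 𝓘(ℝ, V)) (n := ∞) (x := x))
  have h2 : ContMDiff 𝓘(ℝ, V) 𝓘(ℝ, V) ∞
      (fun v : V => v + (x -ᵥ (Classical.arbitrary P : P))) :=
    (contDiff_id.add contDiff_const).contMDiff
  convert! h1.comp h2 using 1
  ext v
  simp [add_vadd]

theorem hasMFDerivAt_vsub_const (x y : P) :
    HasMFDerivAt 𝓘(ℝ, V) 𝓘(ℝ, V) (fun z : P => z -ᵥ x) y (ContinuousLinearMap.id ℝ V) := by
  refine ⟨(contMDiff_vsub_const x).continuous.continuousAt, ?_⟩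
  have h : HasFDerivAt (fun v : V => v + ((Classical.arbitrary P : P) -ᵥ x))
      (ContinuousLinearMap.id ℝ V) (y -ᵥ (Classical.arbitrary P : P)) :=
    (hasFDerivAt_id _).add_const _
  have h' : writtenInExtChartAt 𝓘(ℝ, V) 𝓘(ℝ, V) y (fun z : P => z -ᵥ x) =
      fun v : V => v + ((Classical.arbitrary P : P) -ᵥ x) := by
    ext v
    exact vadd_vsub_assoc v (Classical.arbitrary P) x
  rw [h']
  exact h.hasFDerivWithinAt

/-- The translates of the vector space, as a diffeomorphism onto the affine space. -/
def vaddConstDiffeomorph (x : P) : Diffeomorph 𝓘(ℝ, V) 𝓘(ℝ, V) V P ∞ where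
  toEquiv := Equiv.vaddConst x
  contMDiff_toFun := contMDiff_vadd_const x
  contMDiff_invFun := contMDiff_vsub_const x

variable {V' P' : Type*} [NormedAddCommGroup V'] [InnerProductSpace ℝ V']
  [MetricSpace P'] [NormedAddTorsor V' P']

theorem contMDiff_of_map_vadd {f : P' → P} (A : V' →L[ℝ] V)
    (hf : ∀ x v, f (v +ᵥ x) = A v +ᵥ f x) : ContMDiff 𝓘(ℝ, V') 𝓘(ℝ, V) ∞ f := by
  have o : P' := Classical.arbitrary P'
  have h : f = (fun v : V => v +ᵥ f o) ∘ A ∘ fun y : P' => y -ᵥ o := by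
    ext y
    simp [← hf]
  rw [h]
  exact (contMDiff_vadd_const _).comp (A.contDiff.contMDiff.comp (contMDiff_vsub_const o))

/-- Subtracting a fixed point has the identity as differential, and turns `f` into `A` after a
subtraction in the source. -/
theorem hasMFDerivAt_of_map_vadd {f : P' → P} (A : V' →L[ℝ] V)
    (hf : ∀ x v, f (v +ᵥ x) = A v +ᵥ f x) (x : P') :
    HasMFDerivAt 𝓘(ℝ, V') 𝓘(ℝ, V) f x A := by
  have hd : MDifferentiableAt 𝓘(ℝ, V') 𝓘(ℝ, V) f x :=
    (contMDiff_of_map_vadd A hf).mdifferentiable (by simp) x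
  have h1 := (hasMFDerivAt_vsub_const (f x) (f x)).comp x hd.hasMFDerivAt
  have h2 : HasMFDerivAt 𝓘(ℝ, V') 𝓘(ℝ, V) (A ∘ fun y : P' => y -ᵥ x) x
      (A.comp (ContinuousLinearMap.id ℝ V')) :=
    HasMFDerivAt.comp (f := fun y : P' => y -ᵥ x) x
      (A.hasFDerivAt (x := x -ᵥ x)).hasMFDerivAt (hasMFDerivAt_vsub_const x x)
  have h3 : ((fun z : P => z -ᵥ f x) ∘ f) = (A ∘ fun y : P' => y -ᵥ x) := by
    ext y
    have := hf x (y -ᵥ x)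
    rw [vsub_vadd] at this
    simp [this]
  rw [h3] at h1
  have h4 := hasMFDerivAt_unique h1 h2
  have h5 : mfderiv 𝓘(ℝ, V') 𝓘(ℝ, V) f x = A := h4
  rw [← h5]
  exact hd.hasMFDerivAt

/-- A Euclidean isometry onto the model space is smooth. -/
theorem contMDiff_isometry (G : P ≃ᵃⁱ[ℝ] V) : ContMDiff 𝓘(ℝ, V) 𝓘(ℝ, V) ∞ G := by
  have o : P := Classical.arbitrary P
  have h : (G : P → V) = (fun v : V => v + G o) ∘ G.linearIsometryEquiv ∘
      fun y : P => y -ᵥ o := by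
    ext y
    simp
  rw [h]
  exact ((contDiff_id.add contDiff_const).comp G.linearIsometryEquiv.contDiff).contMDiff.comp
    (contMDiff_vsub_const o)

theorem contMDiff_isometry_symm (G : P ≃ᵃⁱ[ℝ] V) :
    ContMDiff 𝓘(ℝ, V) 𝓘(ℝ, V) ∞ G.symm := by
  have h : (G.symm : V → P) = (fun v : V => v +ᵥ G.symm 0) ∘
      G.symm.linearIsometryEquiv := by
    ext v
    simp [← AffineIsometryEquiv.map_vadd]
  rw [h]
  exact (contMDiff_vadd_const _).comp G.symm.linearIsometryEquiv.contDiff.contMDiff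

theorem hasMFDerivAt_isometry (G : P ≃ᵃⁱ[ℝ] V) (x : P) :
    HasMFDerivAt 𝓘(ℝ, V) 𝓘(ℝ, V) G x
      ((G.linearIsometryEquiv : V ≃L[ℝ] V) : V →L[ℝ] V) := by
  have h : (G : P → V) = (fun v : V => G.linearIsometryEquiv v + G x) ∘
      fun y : P => y -ᵥ x := by
    ext y
    simp
  have h1 : HasFDerivAt (fun v : V => G.linearIsometryEquiv v + G x)
      ((G.linearIsometryEquiv : V ≃L[ℝ] V) : V →L[ℝ] V) (x -ᵥ x) :=
    (G.linearIsometryEquiv : V ≃L[ℝ] V).hasFDerivAt.add_const _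
  have h2 := HasMFDerivAt.comp (f := fun y : P => y -ᵥ x) x h1.hasMFDerivAt
    (hasMFDerivAt_vsub_const x x)
  rw [← h] at h2
  exact h2

end AffineManifold

/-! ### Preferred charts and their differentials -/

section Charts

variable {V M : Type*} [NormedAddCommGroup V] [NormedSpace ℝ V]
  [TopologicalSpace M] [ChartedSpace V M]

/-- The tangent space at `x` is identified with the model space by this very chart. -/
theorem mfderiv_chartAt_self [IsManifold 𝓘(ℝ, V) 1 M] (x : M) :
    mfderiv 𝓘(ℝ, V) 𝓘(ℝ, V) (chartAt V x) x = ContinuousLinearMap.id ℝ V := by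
  have h := mfderiv_extChartAt_self (I := 𝓘(ℝ, V)) (x := x)
  have h' : ((extChartAt 𝓘(ℝ, V) x : M → V)) = chartAt V x := by
    ext y; simp [extChartAt]
  rw [h'] at h
  exact h

/-- A chart, as a partial diffeomorphism. -/
def partialDiffeomorphOfMemMaximalAtlas {e : OpenPartialHomeomorph M V}
    (he : e ∈ IsManifold.maximalAtlas 𝓘(ℝ, V) ∞ M) :
    PartialDiffeomorph 𝓘(ℝ, V) 𝓘(ℝ, V) M V ∞ where
  toPartialEquiv := e.toPartialEquiv
  open_source := e.open_source
  open_target := e.open_target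
  contMDiffOn_toFun := contMDiffOn_of_mem_maximalAtlas he
  contMDiffOn_invFun := contMDiffOn_symm_of_mem_maximalAtlas he

end Charts

/-! ## Local diffeomorphisms -/

section LocalDiffeomorph

variable {E H F G M N : Type*} [NormedAddCommGroup E] [NormedSpace ℝ E] [TopologicalSpace H]
  [NormedAddCommGroup F] [NormedSpace ℝ F] [TopologicalSpace G]
  {I : ModelWithCorners ℝ E H} {J : ModelWithCorners ℝ F G}
  [TopologicalSpace M] [ChartedSpace H M] [TopologicalSpace N] [ChartedSpace G N]
  {n : WithTop ℕ∞}

/-- The restriction of a partial diffeomorphism to an open set. -/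
noncomputable def PartialDiffeomorph.restrOpen (Φ : PartialDiffeomorph I J M N n) (s : Set M) (hs : IsOpen s) :
    PartialDiffeomorph I J M N n where
  toPartialEquiv := (Φ.toOpenPartialHomeomorph.restrOpen s hs).toPartialEquiv
  open_source := (Φ.toOpenPartialHomeomorph.restrOpen s hs).open_source
  open_target := (Φ.toOpenPartialHomeomorph.restrOpen s hs).open_target
  contMDiffOn_toFun := Φ.contMDiffOn_toFun.mono inter_subset_left
  contMDiffOn_invFun := Φ.contMDiffOn_invFun.mono inter_subset_left

theorem IsLocalDiffeomorphAt.congr_of_eventuallyEq {f g : M → N} {x : M}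
    (hf : IsLocalDiffeomorphAt I J n f x) (h : f =ᶠ[𝓝 x] g) :
    IsLocalDiffeomorphAt I J n g x := by
  obtain ⟨Φ, hx, hΦ⟩ := hf
  obtain ⟨s, hs, hso, hxs⟩ := eventually_nhds_iff.1 h
  exact ⟨Φ.restrOpen s hso, ⟨hx, hxs⟩, fun y hy => (hs y hy.2).symm.trans (hΦ hy.1)⟩

/-- Locally `f` is `f ∘ g` after a local inverse of `g`. This lets local diffeomorphisms descend
from `E'` to its quotients. -/
theorem IsLocalDiffeomorph.of_comp {E' H' M' : Type*} [NormedAddCommGroup E'] [NormedSpace ℝ E']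
    [TopologicalSpace H'] {I' : ModelWithCorners ℝ E' H'} [TopologicalSpace M']
    [ChartedSpace H' M'] {f : M → N} {g : M' → M} (hg : IsLocalDiffeomorph I' I n g)
    (hs : Function.Surjective g) (hfg : IsLocalDiffeomorph I' J n (f ∘ g)) :
    IsLocalDiffeomorph I J n f := by
  intro y
  obtain ⟨x, rfl⟩ := hs y
  have h1 := (hg x).localInverse_isLocalDiffeomorphAt
  have h2 : IsLocalDiffeomorphAt I' J n (f ∘ g) ((hg x).localInverse (g x)) := by
    rw [(hg x).localInverse_left_inv (hg x).localInverse_mem_target]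
    exact hfg x
  refine (h1.comp _ _ h2).congr_of_eventuallyEq ?_
  filter_upwards [(hg x).localInverse_eventuallyEq_right] with z hz
  exact congrArg f hz

end LocalDiffeomorph

/-! ## Projections onto quotients of affine spaces -/

section FlatProjection

variable {V P M : Type*} [NormedAddCommGroup V] [InnerProductSpace ℝ V]
  [MetricSpace P] [NormedAddTorsor V P] [TopologicalSpace M] [ChartedSpace V M]

/-- A projection `pr : P → M` with the orbits of a group `Γ` of isometries as fibers, such that the
preferred charts of `M` pull back to elements of `Γ`. -/
structure IsFlatProjection (Γ : Subgroup (P ≃ᵃⁱ[ℝ] P)) (pr : P → M) : Prop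
    extends IsOpenQuotientMap pr where
  apply_eq_apply_iff {x y : P} : pr x = pr y ↔ ∃ γ ∈ Γ, γ x = y
  exists_chart (x : P) : ∃ γ ∈ Γ, ∀ᶠ y in 𝓝 x,
    chartAt V (pr x) (pr y) = γ y -ᵥ (Classical.arbitrary P : P)

theorem isFlatProjection_id : IsFlatProjection (⊥ : Subgroup (P ≃ᵃⁱ[ℝ] P)) (id : P → P) where
  toIsOpenQuotientMap := .id
  apply_eq_apply_iff := by simp
  exists_chart x := ⟨1, one_mem _, .of_forall fun y => rfl⟩

theorem isFlatProjection_quotientMap [FiniteDimensional ℝ V] (Γ : Subgroup (P ≃ᵃⁱ[ℝ] P))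
    [IsTorsionFreeDiscrete Γ] : IsFlatProjection Γ (quotientMap Γ) where
  toIsOpenQuotientMap :=
    (isQuotientCoveringMap_quotientMk_of_properlyDiscontinuousSMul
      (E := P) (G := Γ)).isOpenQuotientMap
  apply_eq_apply_iff {x y} := by
    refine ⟨fun h => ?_, ?_⟩
    · obtain ⟨γ, hγ⟩ : y ∈ orbit Γ x := Quotient.exact h.symm
      exact ⟨γ, γ.2, hγ⟩
    · rintro ⟨γ, hγ, rfl⟩
      exact (Quotient.sound ⟨⟨γ, hγ⟩, rfl⟩ :
        (Quotient.mk (orbitRel Γ P) (γ x)) = Quotient.mk (orbitRel Γ P) x).symm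
  exists_chart x := by
    have hl := (isQuotientCoveringMap_quotientMk_of_properlyDiscontinuousSMul
      (E := P) (G := Γ)).isCoveringMap.isLocalHomeomorph
    have hr : Function.Surjective (Quotient.mk (orbitRel Γ P)) := Quotient.mk_surjective
    -- The preferred chart is a local inverse of the projection based at a chosen point `b` of the
    -- fibre, which need not be `x`; `γ` carries `x` to `b`.
    set b : P := hr.hasRightInverse.choose (quotientMap Γ x)
    have hc : ∀ y : P, chartAt V (quotientMap Γ x) (quotientMap Γ y) =
      hl.localInverseAt b (quotientMap Γ y) -ᵥ (Classical.arbitrary P : P) := fun y => rfl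
    have hb : quotientMap Γ b = quotientMap Γ x := hr.hasRightInverse.choose_spec _
    obtain ⟨γ, hγ⟩ : b ∈ orbit Γ x := Quotient.exact hb
    have hγ' : (γ : P ≃ᵃⁱ[ℝ] P) x = b := hγ
    refine ⟨γ, γ.2, ?_⟩
    have hev : ∀ᶠ y in 𝓝 x, (γ : P ≃ᵃⁱ[ℝ] P) y ∈ (hl.localInverseAt b).target := by
      refine (γ : P ≃ᵃⁱ[ℝ] P).continuous.continuousAt.eventually
        ((hl.localInverseAt b).open_target.mem_nhds ?_)
      rw [hγ']
      exact hl.self_mem_localInverseAt_target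
    filter_upwards [hev] with y hy
    rw [hc y]
    congr 1
    have h1 : quotientMap Γ ((γ : P ≃ᵃⁱ[ℝ] P) y) = quotientMap Γ y :=
      Quotient.sound ⟨γ, rfl⟩
    rw [← h1]
    have := (hl.localInverseAt b).right_inv hy
    rwa [hl.localInverseAt_symm] at this

namespace IsFlatProjection

variable {Γ : Subgroup (P ≃ᵃⁱ[ℝ] P)} {pr : P → M} (h : IsFlatProjection Γ pr)
include h

theorem apply_smul {γ : P ≃ᵃⁱ[ℝ] P} (hγ : γ ∈ Γ) (x : P) : pr (γ x) = pr x :=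
  (h.apply_eq_apply_iff.2 ⟨γ, hγ, rfl⟩).symm

theorem exists_isometry_chartAt (x : P) : ∃ γ ∈ Γ, ∃ G : P ≃ᵃⁱ[ℝ] V,
    G.linearIsometryEquiv = linearPart γ ∧ ∀ᶠ y in 𝓝 x, chartAt V (pr x) (pr y) = G y := by
  obtain ⟨γ, hγ, hx⟩ := h.exists_chart x
  exact ⟨γ, hγ, γ.trans (AffineIsometryEquiv.vaddConst ℝ (Classical.arbitrary P : P)).symm,
    by ext v; rfl, hx⟩

/-- Isometric charts of the quotient pull back to isometries of the affine space. -/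
theorem exists_isometry {e : OpenPartialHomeomorph M V} (he : e ∈ flatCharts V M) {x : P}
    (hx : pr x ∈ e.source) : ∃ G : P ≃ᵃⁱ[ℝ] V, ∀ᶠ y in 𝓝 x, e (pr y) = G y := by
  obtain ⟨-, -, G, -, hG⟩ := h.exists_isometry_chartAt x
  set c := chartAt V (pr x) with hc
  have hcx : pr x ∈ c.source := mem_chart_source V (pr x)
  -- The transition from the preferred chart to `e` is locally an isometry `g` of `V`, to be
  -- composed with `G`.
  have h1 : c.symm ≫ₕ e ∈ euclideanGroupoid V :=
    ((mem_maximalAtlas_iff.1 he) c (chart_mem_atlas V (pr x))).2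
  obtain ⟨g, hg⟩ := h1.1 (c (pr x)) (by
    simp only [OpenPartialHomeomorph.trans_source, OpenPartialHomeomorph.symm_source,
      mem_inter_iff, mem_preimage]
    exact ⟨c.map_source hcx, by rwa [c.left_inv hcx]⟩)
  refine ⟨G.trans g, ?_⟩
  have h2 : ContinuousAt (fun y => c (pr y)) x :=
    (c.continuousAt hcx).comp h.continuous.continuousAt
  filter_upwards [hG, h2.eventually hg,
    h.continuous.continuousAt.eventually (c.open_source.mem_nhds hcx)] with y hy1 hy2 hy3
  rw [AffineIsometryEquiv.coe_trans, Function.comp_apply, ← hy1, ← hy2]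
  simp [c.left_inv hy3]

variable [IsManifold 𝓘(ℝ, V) ∞ M]

omit h [InnerProductSpace ℝ V] [NormedAddTorsor V P] [ChartedSpace V M]
  [IsManifold 𝓘(ℝ, V) ∞ M] in
theorem eventuallyEq_symm_comp {e : OpenPartialHomeomorph M V} {G : P → V} {x : P}
    (hc : ContinuousAt pr x) (hx : pr x ∈ e.source) (hG : ∀ᶠ y in 𝓝 x, e (pr y) = G y) :
    e.symm ∘ G =ᶠ[𝓝 x] pr := by
  filter_upwards [hG, hc.eventually (e.open_source.mem_nhds hx)] with y hy1 hy2
  rw [Function.comp_apply, ← hy1, e.left_inv hy2]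

/-- Near each point, `pr` is an isometry onto `V` followed by an inverse chart. -/
theorem isLocalDiffeomorph : IsLocalDiffeomorph 𝓘(ℝ, V) 𝓘(ℝ, V) ∞ pr := by
  intro x
  obtain ⟨-, -, G, -, hG⟩ := h.exists_isometry_chartAt x
  have hcx : pr x ∈ (chartAt V (pr x)).source := mem_chart_source V (pr x)
  let G' : Diffeomorph 𝓘(ℝ, V) 𝓘(ℝ, V) P V ∞ :=
    ⟨G.toEquiv, contMDiff_isometry G, contMDiff_isometry_symm G⟩
  have h1 : IsLocalDiffeomorphAt 𝓘(ℝ, V) 𝓘(ℝ, V) ∞ G x := G'.isLocalDiffeomorph x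
  have h2 := PartialDiffeomorph.isLocalDiffeomorphAt _ _ _ (partialDiffeomorphOfMemMaximalAtlas
    (IsManifold.chart_mem_maximalAtlas (I := 𝓘(ℝ, V)) (n := ∞) (pr x))).symm
      (x := G x) (by rw [← hG.self_of_nhds]; exact (chartAt V (pr x)).map_source hcx)
  exact (h1.comp _ _ h2).congr_of_eventuallyEq
    (eventuallyEq_symm_comp h.continuous.continuousAt hcx hG)

theorem mdifferentiableAt (x : P) : MDifferentiableAt 𝓘(ℝ, V) 𝓘(ℝ, V) pr x :=
  h.isLocalDiffeomorph.mdifferentiable (by simp) x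

/-- If the chart `e` pulls back to the isometry `G`, the differentials are related likewise. -/
theorem mfderiv_chart_comp {e : OpenPartialHomeomorph M V} {G : P ≃ᵃⁱ[ℝ] V} {x : P}
    (he : MDifferentiableAt 𝓘(ℝ, V) 𝓘(ℝ, V) e (pr x)) (hG : ∀ᶠ y in 𝓝 x, e (pr y) = G y) (v : V) :
    chartDeriv e (pr x) (mfderiv 𝓘(ℝ, V) 𝓘(ℝ, V) pr x v) = G.linearIsometryEquiv v := by
  have h1 := he.hasMFDerivAt.comp x (h.mdifferentiableAt x).hasMFDerivAt
  have h2 := (hasMFDerivAt_isometry G x).congr_of_eventuallyEq (f₁ := e ∘ pr) hG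
  exact congrArg (fun A : V →L[ℝ] V => A v) (hasMFDerivAt_unique h1 h2)

/-- In the preferred charts, the differential of the projection is the linear part of an element
of `Γ`. -/
theorem exists_mfderiv_eq (x : P) : ∃ γ ∈ Γ, ∀ v : V,
    mfderiv 𝓘(ℝ, V) 𝓘(ℝ, V) pr x v = linearPart γ v := by
  obtain ⟨γ, hγ, G, hGγ, hG⟩ := h.exists_isometry_chartAt x
  have : IsManifold 𝓘(ℝ, V) 1 M := IsManifold.of_le (n := ∞) (by simp)
  refine ⟨γ, hγ, fun v => ?_⟩
  have h1 := h.mfderiv_chart_comp (((mdifferentiable_chart (I := 𝓘(ℝ, V)) (pr x)).mdifferentiableAt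
    (mem_chart_source V (pr x)))) hG v
  rw [chartDeriv, mfderiv_chartAt_self] at h1
  rw [← hGγ]
  exact h1

theorem flatInner_mfderiv (x : P) (v w : V) :
    flatInner (mfderiv 𝓘(ℝ, V) 𝓘(ℝ, V) pr x v) (mfderiv 𝓘(ℝ, V) 𝓘(ℝ, V) pr x w) = inner ℝ v w := by
  obtain ⟨γ, -, hγ⟩ := h.exists_mfderiv_eq x
  have h1 : flatInner (mfderiv 𝓘(ℝ, V) 𝓘(ℝ, V) pr x v) (mfderiv 𝓘(ℝ, V) 𝓘(ℝ, V) pr x w) =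
    inner ℝ (linearPart γ v) (linearPart γ w) := by rw [← hγ, ← hγ]; rfl
  rw [h1, LinearIsometryEquiv.inner_map_map]

end IsFlatProjection

end FlatProjection

section Covering

variable {V P : Type*} [NormedAddCommGroup V] [InnerProductSpace ℝ V] [FiniteDimensional ℝ V]
  [MetricSpace P] [NormedAddTorsor V P]

theorem isRiemannianCovering_quotientMap (Γ : Subgroup (P ≃ᵃⁱ[ℝ] P)) [IsTorsionFreeDiscrete Γ] :
    IsRiemannianCovering (V := V) (quotientMap Γ) := by
  have h := isFlatProjection_quotientMap Γ
  exact ⟨(isQuotientCoveringMap_quotientMk_of_properlyDiscontinuousSMul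
    (E := P) (G := Γ)).isCoveringMap, h.surjective, h.isLocalDiffeomorph,
    fun x a b => h.flatInner_mfderiv x a b⟩

end Covering

/-! ## Immersions and the inverse function theorem -/

section Immersion

variable {E V F M N : Type*} [NormedAddCommGroup E] [NormedSpace ℝ E]
  [NormedAddCommGroup V] [NormedSpace ℝ V] [NormedAddCommGroup F] [NormedSpace ℝ F]
  [TopologicalSpace M] [ChartedSpace E M]
  [TopologicalSpace N] [ChartedSpace V N]

theorem mdifferentiable_of_mem_maximalAtlas {e : OpenPartialHomeomorph M E}
    (he : e ∈ IsManifold.maximalAtlas 𝓘(ℝ, E) ∞ M) :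
    e.MDifferentiable 𝓘(ℝ, E) 𝓘(ℝ, E) :=
  ⟨(contMDiffOn_of_mem_maximalAtlas he).mdifferentiableOn (by simp),
    (contMDiffOn_symm_of_mem_maximalAtlas he).mdifferentiableOn (by simp)⟩

/-- In adapted charts `f` is `v ↦ (v, 0)`, so a linear projection after `f` recovers the chart of
the domain, whose differential is injective. -/
theorem mfderiv_injective_of_isImmersionAt {f : M → N} {x : M}
    (hf : IsImmersionAtOfComplement F 𝓘(ℝ, E) 𝓘(ℝ, V) ∞ f x) :
    Function.Injective (mfderiv 𝓘(ℝ, E) 𝓘(ℝ, V) f x) := by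
  have hφ := mdifferentiable_of_mem_maximalAtlas hf.domChart_mem_maximalAtlas
  have hψ := mdifferentiable_of_mem_maximalAtlas hf.codChart_mem_maximalAtlas
  have hfd : MDifferentiableAt 𝓘(ℝ, E) 𝓘(ℝ, V) f x :=
    hf.contMDiffAt.mdifferentiableAt (by simp)
  let A : V →L[ℝ] E := (ContinuousLinearMap.fst ℝ E F).comp (hf.equiv.symm : V →L[ℝ] E × F)
  have h1 : A ∘ hf.codChart ∘ f =ᶠ[𝓝 x] hf.domChart := by
    filter_upwards [hf.domChart.open_source.mem_nhds hf.mem_domChart_source] with y hy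
    have := hf.writtenInCharts
      (show hf.domChart y ∈ (hf.domChart.extend 𝓘(ℝ, E)).target by
        simpa using hf.domChart.map_source hy)
    simp only [Function.comp_apply, OpenPartialHomeomorph.extend, modelWithCornersSelf_partialEquiv,
      PartialEquiv.trans_refl, OpenPartialHomeomorph.coe_toPartialEquiv_symm,
      OpenPartialHomeomorph.toFun_eq_coe, hf.domChart.left_inv hy] at this
    simp [A, this]
  have h2 := (hφ.mdifferentiableAt hf.mem_domChart_source).hasMFDerivAt.congr_of_eventuallyEq h1
  have h3 := (A.hasMFDerivAt (x := hf.codChart (f x))).comp x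
    ((hψ.mdifferentiableAt hf.mem_codChart_source).hasMFDerivAt.comp x hfd.hasMFDerivAt)
  have h4 := hasMFDerivAt_unique h2 h3
  have h5 := hφ.mfderiv_injective hf.mem_domChart_source
  rw [h4] at h5
  exact Function.Injective.of_comp (f := fun v => A (mfderiv 𝓘(ℝ, V) 𝓘(ℝ, V) hf.codChart (f x) v)) h5

end Immersion

section InverseFunction

variable {E V : Type*} [NormedAddCommGroup E] [NormedSpace ℝ E] [CompleteSpace E]
  [NormedAddCommGroup V] [InnerProductSpace ℝ V] [FiniteDimensional ℝ V]

/-- A smooth map all of whose differentials are isomorphisms onto a fixed subspace is locally a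
diffeomorphism onto an open subset of a translate of this subspace. -/
theorem exists_partialDiffeomorph_of_range_fderiv (W : Submodule ℝ V) {u : E → V} {O : Set E}
    (hO : IsOpen O) (hu : ContDiffOn ℝ ∞ u O) {a₀ : E} (ha₀ : a₀ ∈ O) (hua₀ : u a₀ = 0)
    (hinj : ∀ a ∈ O, Function.Injective (fderiv ℝ u a))
    (hrange : ∀ a ∈ O, (fderiv ℝ u a).range = W) :
    ∃ Φ : PartialDiffeomorph 𝓘(ℝ, E) 𝓘(ℝ, W) E W ∞,
      a₀ ∈ Φ.source ∧ ∀ a ∈ Φ.source, a ∈ O ∧ (Φ a : V) = u a := by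
  obtain ⟨r, hr, hrO⟩ := Metric.isOpen_iff.1 hO a₀ ha₀
  set B := Metric.ball a₀ r
  have hBo : IsOpen B := Metric.isOpen_ball
  have huc : ∀ a ∈ B, ContDiffAt ℝ ∞ u a := fun a ha =>
    (hu a (hrO ha)).contDiffAt (hO.mem_nhds (hrO ha))
  have hud : ∀ a ∈ B, HasFDerivAt u (fderiv ℝ u a) a := fun a ha =>
    ((huc a ha).differentiableAt (by simp)).hasFDerivAt
  -- On the ball, `w - u` has zero derivative and it vanishes at `a₀`. Hence `u` takes values in `W`
  -- there, and the inverse function theorem applies to `w`, whose target has the right dimension.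
  let w : E → W := fun a => W.orthogonalProjectionOnto (u a)
  have hwc : ∀ a ∈ B, ContDiffAt ℝ ∞ w a := fun a ha =>
    W.orthogonalProjectionOnto.contDiff.contDiffAt.comp a (huc a ha)
  have hwd : ∀ a ∈ B, HasFDerivAt w (W.orthogonalProjectionOnto.comp (fderiv ℝ u a)) a := fun a ha =>
    W.orthogonalProjectionOnto.hasFDerivAt.comp a (hud a ha)
  have hmem : ∀ a ∈ B, ∀ v, fderiv ℝ u a v ∈ W := fun a ha v => by
    rw [← hrange a (hrO ha)]
    exact ⟨v, rfl⟩
  have hproj : ∀ a ∈ B, ∀ v, (W.orthogonalProjectionOnto (fderiv ℝ u a v) : V) = fderiv ℝ u a v :=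
    fun a ha v => Submodule.starProjection_eq_self_iff.2 (hmem a ha v)
  have hd : ∀ a ∈ B, HasFDerivAt (fun a => (w a : V) - u a) (0 : E →L[ℝ] V) a := fun a ha => by
    have := ((W.subtypeL.hasFDerivAt (x := w a)).comp a (hwd a ha)).sub (hud a ha)
    convert! this using 1
    ext v
    simp [hproj a ha v]
  have hw : ∀ a ∈ B, (w a : V) = u a := fun a ha => by
    have h1 := hBo.is_const_of_fderiv_eq_zero (convex_ball a₀ r).isPreconnected
      (fun b hb => (hd b hb).differentiableAt.differentiableWithinAt)
      (fun b hb => (hd b hb).fderiv) ha (Metric.mem_ball_self hr)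
    rw [← sub_eq_zero]
    change (w a : V) - u a = (w a₀ : V) - u a₀ at h1
    rw [h1, hua₀]
    simp [w, hua₀]
  have hbij : ∀ a ∈ B, Function.Bijective (W.orthogonalProjectionOnto.comp (fderiv ℝ u a)) := by
    refine fun a ha => ⟨fun v v' hv => hinj a (hrO ha) ?_, fun z => ?_⟩
    · rw [← hproj a ha v, ← hproj a ha v']
      exact congrArg Subtype.val hv
    · obtain ⟨v, hv⟩ : (z : V) ∈ (fderiv ℝ u a).range := by
        rw [hrange a (hrO ha)]
        exact z.2
      refine ⟨v, Subtype.ext ?_⟩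
      exact (hproj a ha v).trans hv
  let f' : ∀ a ∈ B, E ≃L[ℝ] W := fun a ha =>
    ContinuousLinearEquiv.ofBijective (W.orthogonalProjectionOnto.comp (fderiv ℝ u a))
      (LinearMap.ker_eq_bot.2 (hbij a ha).1) (LinearMap.range_eq_top.2 (hbij a ha).2)
  have hf' : ∀ a (ha : a ∈ B), HasFDerivAt w (f' a ha : E →L[ℝ] W) a := fun a ha => by
    convert! hwd a ha
  have ha₀B : a₀ ∈ B := Metric.mem_ball_self hr
  let e := ((hwc a₀ ha₀B).toOpenPartialHomeomorph w (hf' a₀ ha₀B) (by simp)).restrOpen B hBo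
  have heB : ∀ a ∈ e.source, a ∈ B := fun a ha => ha.2
  have hew : ∀ a, e a = w a := fun a => rfl
  refine ⟨⟨e.toPartialEquiv, e.open_source, e.open_target, ?_, ?_⟩, ?_, ?_⟩
  · rw [contMDiffOn_iff_contDiffOn]
    exact fun a ha => (hwc a (heB a ha)).contDiffWithinAt
  · rw [contMDiffOn_iff_contDiffOn]
    intro b hb
    have hb' := heB _ (e.map_target hb)
    exact (e.contDiffAt_symm hb (hf' _ hb') (hwc _ hb')).contDiffWithinAt
  · exact ⟨(hwc a₀ ha₀B).mem_toOpenPartialHomeomorph_source (hf' a₀ ha₀B) (by simp), ha₀B⟩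
  · exact fun a ha => ⟨hrO (heB a ha), hw a (heB a ha)⟩

end InverseFunction

/-! ## Integral manifolds of parallel distributions -/

section ParallelField

variable {V : Type v} {P M : Type u} [NormedAddCommGroup V] [InnerProductSpace ℝ V]
  [MetricSpace P] [NormedAddTorsor V P] [TopologicalSpace M] [ChartedSpace V M]

variable (M) in
/-- The distribution given by a fixed subspace in all the preferred charts. -/
def parallelField (W : Submodule ℝ V) : TangentField V M := fun _ => W

/-- Invariance of a subspace under the linear parts of all the elements of a group. -/
def IsLinearInvariant (Γ : Subgroup (P ≃ᵃⁱ[ℝ] P)) (W : Submodule ℝ V) : Prop :=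
  ∀ γ ∈ Γ, ∀ v ∈ W, linearPart γ v ∈ W

theorem IsLinearInvariant.mono {Γ Γ' : Subgroup (P ≃ᵃⁱ[ℝ] P)} {W : Submodule ℝ V}
    (hW : IsLinearInvariant Γ W) (h : Γ' ≤ Γ) : IsLinearInvariant Γ' W :=
  fun γ hγ => hW γ (h hγ)

/-- Invariance under the inverse element turns the inclusion of the image in `W` into equality. -/
theorem IsLinearInvariant.exists_apply_eq {Γ : Subgroup (P ≃ᵃⁱ[ℝ] P)} {W : Submodule ℝ V}
    (hW : IsLinearInvariant Γ W) {γ : P ≃ᵃⁱ[ℝ] P} (hγ : γ ∈ Γ) {w : V} (hw : w ∈ W) :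
    ∃ v ∈ W, linearPart γ v = w := by
  refine ⟨linearPart γ⁻¹ w, hW _ (inv_mem hγ) w hw, ?_⟩
  have h1 : linearPart γ * linearPart γ⁻¹ = 1 := by rw [← map_mul, mul_inv_cancel, map_one]
  exact congrArg (fun A : V ≃ₗᵢ[ℝ] V => A w) h1

theorem euclideanGroupoid_le : euclideanGroupoid V ≤ contDiffGroupoid ∞ 𝓘(ℝ, V) := by
  refine groupoid_of_pregroupoid_le _ _ fun f s hf => ?_
  suffices ContDiffOn ℝ ∞ f s by simpa [contDiffPregroupoid] using this
  intro x hx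
  obtain ⟨g, hg⟩ := hf x hx
  have h1 : ContDiff ℝ ∞ g := contMDiff_iff_contDiff.1 (by
    have h2 : (g : V → V) = fun y => g.linearIsometryEquiv y + g 0 := by
      funext y
      simpa using g.map_vadd 0 y
    rw [h2]
    exact (g.linearIsometryEquiv.contDiff.add contDiff_const).contMDiff)
  exact (h1.contDiffAt.congr_of_eventuallyEq hg).contDiffWithinAt

theorem mem_maximalAtlas_of_mem_flatCharts {e : OpenPartialHomeomorph M V}
    (he : e ∈ flatCharts V M) : e ∈ IsManifold.maximalAtlas 𝓘(ℝ, V) ∞ M :=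
  StructureGroupoid.maximalAtlas_mono euclideanGroupoid_le he

namespace IsFlatProjection

variable {Γ : Subgroup (P ≃ᵃⁱ[ℝ] P)} {pr : P → M} (h : IsFlatProjection Γ pr)
  [IsManifold 𝓘(ℝ, V) ∞ M] {W : Submodule ℝ V} (hW : IsLinearInvariant Γ W)
include h hW

/-- The differential of `pr` is the linear part of an element of `Γ`, which maps `W` onto itself. -/
theorem isProjectable : (parallelField P W).IsProjectable pr (parallelField M W) := by
  intro x
  obtain ⟨γ, hγ, hd⟩ := h.exists_mfderiv_eq x
  refine le_antisymm ?_ fun w hw => ?_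
  · rintro _ ⟨v, hv, rfl⟩
    exact (congrArg (· ∈ W) (hd v)).mpr (hW γ hγ v hv)
  · obtain ⟨v, hv, rfl⟩ := hW.exists_apply_eq hγ hw
    exact ⟨v, hv, hd v⟩

/-- By projectability, the field on `M` seen in `e` is the constant field on `E` seen in `e ∘ pr`,
which is `G`. The right-hand side depends on `G` only, hence the local constancy. -/
theorem inChart_eq {e : OpenPartialHomeomorph M V}
    (he : e ∈ IsManifold.maximalAtlas 𝓘(ℝ, V) ∞ M) {G : P ≃ᵃⁱ[ℝ] V} {x : P}
    (hx : pr x ∈ e.source) (hG : ∀ᶠ y in 𝓝 x, e (pr y) = G y) :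
    (parallelField M W).inChart e (pr x) =
      W.map (G.linearIsometryEquiv : V →ₗ[ℝ] V) := by
  have hd := (mdifferentiable_of_mem_maximalAtlas he).mdifferentiableAt hx
  rw [TangentField.inChart, ← h.isProjectable hW x]
  ext w
  constructor
  · rintro ⟨_, ⟨v, hv, rfl⟩, rfl⟩
    exact ⟨v, hv, (h.mfderiv_chart_comp hd hG v).symm⟩
  · rintro ⟨v, hv, rfl⟩
    exact ⟨_, ⟨v, hv, rfl⟩, h.mfderiv_chart_comp hd hG v⟩

theorem eventually_inChart_eq {e : OpenPartialHomeomorph M V}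
    (he : e ∈ IsManifold.maximalAtlas 𝓘(ℝ, V) ∞ M) {G : P ≃ᵃⁱ[ℝ] V} {x : P}
    (hx : pr x ∈ e.source) (hG : ∀ᶠ y in 𝓝 x, e (pr y) = G y) :
    ∀ᶠ m in 𝓝 (pr x), (parallelField M W).inChart e m =
      W.map (G.linearIsometryEquiv : V →ₗ[ℝ] V) := by
  have h1 : ∀ᶠ y in 𝓝 x, (parallelField M W).inChart e (pr y) =
      W.map (G.linearIsometryEquiv : V →ₗ[ℝ] V) := by
    filter_upwards [hG.eventually_nhds,
      h.continuous.continuousAt.eventually (e.open_source.mem_nhds hx)] with y hy1 hy2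
    exact h.inChart_eq hW he hy2 hy1
  -- Openness of `pr` transfers the statement from points near `x` to points near `pr x`.
  have h2 := h.isOpenMap.image_mem_nhds h1
  filter_upwards [h2] with m hm
  obtain ⟨y, hy, rfl⟩ := hm
  exact hy

theorem isParallel : (parallelField M W).IsParallel := by
  intro e he m hm
  obtain ⟨x, rfl⟩ := h.surjective m
  obtain ⟨G, hG⟩ := h.exists_isometry he hm
  have h1 := h.eventually_inChart_eq hW (mem_maximalAtlas_of_mem_flatCharts he) hm hG
  filter_upwards [h1] with y hy
  rw [hy, h1.self_of_nhds]

end IsFlatProjection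

end ParallelField

namespace Submanifold

variable {V : Type v} {M : Type u} [NormedAddCommGroup V] [InnerProductSpace ℝ V]
  [TopologicalSpace M] [ChartedSpace V M] (N : Submanifold V M)

theorem contMDiff_incl : ContMDiff (𝓡 N.dim) 𝓘(ℝ, V) ∞ N.incl := by
  obtain ⟨F, _, _, hF⟩ := N.incl_immersion
  exact hF.contMDiff

theorem mdifferentiableAt_incl (p : N.Pts) :
    MDifferentiableAt (𝓡 N.dim) 𝓘(ℝ, V) N.incl p :=
  N.contMDiff_incl.mdifferentiable (by simp) p

theorem dincl_injective (p : N.Pts) : Function.Injective (N.dincl p) := by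
  obtain ⟨F, _, _, hF⟩ := N.incl_immersion
  exact mfderiv_injective_of_isImmersionAt (hF p)

end Submanifold

section IntegralManifold

variable {V : Type v} {P M : Type u} [NormedAddCommGroup V] [InnerProductSpace ℝ V]
  [FiniteDimensional ℝ V] [MetricSpace P] [NormedAddTorsor V P] [TopologicalSpace M]
  [ChartedSpace V M] [IsManifold 𝓘(ℝ, V) ∞ M]
  {Γ : Subgroup (P ≃ᵃⁱ[ℝ] P)} {pr : P → M} (h : IsFlatProjection Γ pr)
  {E' : AffineSubspace ℝ P} [Nonempty E'] (hW : IsLinearInvariant Γ E'.direction)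
include h hW

/-- Integral manifolds of a parallel distribution are locally the images of its affine leaves. -/
theorem IsFlatProjection.exists_partialDiffeomorph (N : Submanifold V M)
    (hN : N.IsIntegral (parallelField M E'.direction)) (p : N.Pts) (x : E')
    (hpx : N.incl p = pr x) :
    ∃ Φ : PartialDiffeomorph 𝓘(ℝ, E'.direction) (𝓡 N.dim) E' N.Pts ∞,
      x ∈ Φ.source ∧ ∀ y ∈ Φ.source, N.incl (Φ y) = pr y := by
  obtain ⟨-, -, G, -, hG⟩ := h.exists_isometry_chartAt (x : P)
  set c := chartAt V (pr x) with hc_def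
  have hc : c ∈ IsManifold.maximalAtlas 𝓘(ℝ, V) ∞ M :=
    IsManifold.chart_mem_maximalAtlas (I := 𝓘(ℝ, V)) (n := ∞) (pr x)
  have hcx : pr x ∈ c.source := mem_chart_source V (pr x)
  set φ := chartAt (EuclideanSpace ℝ (Fin N.dim)) p with hφ_def
  have hφ : φ ∈ IsManifold.maximalAtlas (𝓡 N.dim) ∞ N.Pts :=
    IsManifold.chart_mem_maximalAtlas (I := 𝓡 N.dim) (n := ∞) p
  have hφp : p ∈ φ.source := mem_chart_source _ p
  have hGx : G.symm (c (pr x)) = x := by rw [hG.self_of_nhds, G.symm_apply_apply]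
  have hcG : Tendsto (fun m => G.symm (c m)) (𝓝 (pr x)) (𝓝 (x : P)) := by
    have h1 : ContinuousAt (fun m => G.symm (c m)) (pr x) :=
      G.symm.continuous.continuousAt.comp (c.continuousAt hcx)
    rwa [ContinuousAt, hGx] at h1
  have hS : ∀ᶠ m in 𝓝 (pr x), c (pr (G.symm (c m))) = G (G.symm (c m)) ∧
      pr (G.symm (c m)) ∈ c.source := by
    refine hcG.eventually (p := fun y => c (pr y) = G y ∧ pr y ∈ c.source) ?_
    exact hG.and (h.continuous.continuousAt.eventually (c.open_source.mem_nhds hcx))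
  -- On `U` the map `G⁻¹ ∘ c` is a section of `pr`, and the distribution seen in `c` is constantly
  -- `G(W)`, with `W` the direction of `E'`.
  obtain ⟨U, hU, hUo, hxU⟩ := eventually_nhds_iff.1
    ((hS.and (h.eventually_inChart_eq hW hc hcx hG)).and (c.open_source.mem_nhds hcx))
  have hpr : ∀ m ∈ U, pr (G.symm (c m)) = m := fun m hm => by
    obtain ⟨⟨⟨h1, h2⟩, -⟩, h3⟩ := hU m hm
    rw [G.apply_symm_apply] at h1
    exact c.injOn h2 h3 h1
  -- The submanifold in the chart `φ`, lifted to `E` by the section and translated so that `φ p`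
  -- goes to `0`. Its differentials are injective with range the direction of `E'`, because `G⁻¹`
  -- undoes the image under `G`.
  let u : EuclideanSpace ℝ (Fin N.dim) → V := fun a => G.symm (c (N.incl (φ.symm a))) -ᵥ (x : P)
  let O := φ.target ∩ φ.symm ⁻¹' (N.incl ⁻¹' U)
  have hO : IsOpen O :=
    φ.symm.isOpen_inter_preimage (hUo.preimage N.contMDiff_incl.continuous)
  have hT : ContMDiff 𝓘(ℝ, V) 𝓘(ℝ, V) ∞ (fun v : V => G.symm v -ᵥ (x : P)) :=
    (contMDiff_vsub_const (x : P)).comp (contMDiff_isometry_symm G)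
  have hu : ContDiffOn ℝ ∞ u O := by
    rw [← contMDiffOn_iff_contDiffOn]
    refine hT.comp_contMDiffOn ((contMDiffOn_of_mem_maximalAtlas hc).comp
      (N.contMDiff_incl.comp_contMDiffOn
        ((contMDiffOn_symm_of_mem_maximalAtlas hφ).mono inter_subset_left)) ?_)
    exact fun a ha => (hU _ ha.2).2
  have hTd : ∀ v, HasFDerivAt (fun v : V => G.symm v -ᵥ (x : P))
      ((G.linearIsometryEquiv.symm : V ≃L[ℝ] V) : V →L[ℝ] V) v := fun v => by
    have h1 : (fun v : V => G.symm v -ᵥ (x : P)) =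
        fun v => G.linearIsometryEquiv.symm v - G.linearIsometryEquiv.symm (G x) := by
      ext v
      rw [← map_sub]
      apply G.linearIsometryEquiv.injective
      rw [LinearIsometryEquiv.apply_symm_apply, ← vsub_eq_sub]
      simp
    rw [h1]
    exact (G.linearIsometryEquiv.symm : V ≃L[ℝ] V).hasFDerivAt.sub_const _
  have hcd := mdifferentiable_of_mem_maximalAtlas hc
  have hφd := mdifferentiable_of_mem_maximalAtlas hφ
  have hud : ∀ a ∈ O, ∀ v, fderiv ℝ u a v = G.linearIsometryEquiv.symm
      (chartDeriv c (N.incl (φ.symm a)) (N.dincl (φ.symm a)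
        (mfderiv (𝓡 N.dim) (𝓡 N.dim) φ.symm a v))) := fun a ha v => by
    have h1 := (hTd (c (N.incl (φ.symm a)))).hasMFDerivAt.comp a
      ((hcd.mdifferentiableAt (hU _ ha.2).2).hasMFDerivAt.comp a
        ((N.mdifferentiableAt_incl (φ.symm a)).hasMFDerivAt.comp a
          (hφd.mdifferentiableAt_symm ha.1).hasMFDerivAt))
    have h2 := h1.mfderiv
    rw [mfderiv_eq_fderiv] at h2
    exact congrArg (fun A : EuclideanSpace ℝ (Fin N.dim) →L[ℝ] V => A v) h2
  obtain ⟨Φ, hΦ1, hΦ2⟩ := exists_partialDiffeomorph_of_range_fderiv E'.direction hO hu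
    (a₀ := φ p) ⟨φ.map_source hφp, by
      rw [mem_preimage, mem_preimage, φ.left_inv hφp, hpx]; exact hxU⟩
    (by simp only [u]; rw [φ.left_inv hφp, hpx, hGx, vsub_self])
    (fun a ha => by
      intro v w hvw
      rw [hud a ha, hud a ha] at hvw
      exact hφd.symm.mfderiv_injective ha.1 (N.dincl_injective _
        (hcd.mfderiv_injective (hU _ ha.2).2 (G.linearIsometryEquiv.symm.injective hvw))))
    (fun a ha => by
      have h1 := (hU _ ha.2).1.2
      have h2 := hN (φ.symm a)
      ext w
      constructor
      · rintro ⟨v, rfl⟩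
        obtain ⟨w, hw, hw'⟩ := h1.le ⟨_, h2.le ⟨mfderiv (𝓡 N.dim) (𝓡 N.dim) φ.symm a v, rfl⟩, rfl⟩
        have h3 : fderiv ℝ u a v = w := by
          rw [hud a ha]
          apply G.linearIsometryEquiv.injective
          rw [LinearIsometryEquiv.apply_symm_apply]
          exact hw'.symm
        exact (congrArg (· ∈ E'.direction) h3).mpr hw
      · intro hw
        obtain ⟨z, hz, hz'⟩ := h1.ge ⟨w, hw, rfl⟩
        obtain ⟨t, rfl⟩ := h2.ge hz
        obtain ⟨v, rfl⟩ := hφd.symm.mfderiv_surjective ha.1 t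
        refine ⟨v, (hud a ha v).trans ?_⟩
        apply G.linearIsometryEquiv.injective
        rw [LinearIsometryEquiv.apply_symm_apply]
        exact hz')
  -- A local lift of `N` to `E'`: `Ψ` takes `p` to `x` and satisfies `pr ∘ Ψ = incl`. Its inverse is
  -- the required parametrization.
  let Ψ := ((partialDiffeomorphOfMemMaximalAtlas hφ).trans Φ).trans
    (vaddConstDiffeomorph x).toPartialDiffeomorph
  have hΨ : ∀ q ∈ Ψ.source, pr (Ψ q : E') = N.incl q := by
    rintro q ⟨⟨hq, hq'⟩, -⟩
    have hq0 : q ∈ φ.source := hq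
    obtain ⟨h1, h2⟩ := hΦ2 (φ q) hq'
    have h3 : ((Ψ q : E') : P) = (Φ (φ q) : V) +ᵥ (x : P) := rfl
    have h4 : N.incl q ∈ U := by
      have := h1.2
      rwa [mem_preimage, mem_preimage, φ.left_inv hq0] at this
    rw [h3, h2]
    simp only [u]
    rw [vsub_vadd, φ.left_inv hq0, hpr _ h4]
  refine ⟨Ψ.symm, ?_, fun y hy => ?_⟩
  · have h1 : p ∈ Ψ.source := ⟨⟨hφp, hΦ1⟩, trivial⟩
    have h2 : Ψ p = x := by
      apply Subtype.ext
      have h3 : ((Ψ p : E') : P) = (Φ (φ p) : V) +ᵥ (x : P) := rfl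
      rw [h3, (hΦ2 _ hΦ1).2]
      simp only [u]
      rw [vsub_vadd, φ.left_inv hφp, hpx, hGx]
    rw [← h2]
    exact Ψ.map_source h1
  · refine (hΨ _ (Ψ.map_target hy)).symm.trans ?_
    exact congrArg (fun z : E' => pr z) (Ψ.right_inv hy)

end IntegralManifold

/-! ## The group induced on an affine subspace -/

section RestrictedGroup

variable {V : Type v} {P : Type u} [NormedAddCommGroup V] [InnerProductSpace ℝ V]
  [MetricSpace P] [NormedAddTorsor V P]

/-- The isometries of an affine subspace which are restrictions of elements of its stabilizer. -/
def restrictedGroup (Γ : Subgroup (P ≃ᵃⁱ[ℝ] P)) (E' : AffineSubspace ℝ P) [Nonempty E'] :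
    Subgroup (E' ≃ᵃⁱ[ℝ] E') where
  carrier := {g | ∃ σ ∈ stabilizerIn Γ (E' : Set P), ∀ x : E', (g x : P) = σ x}
  one_mem' := ⟨1, one_mem _, fun _ => rfl⟩
  mul_mem' := by
    rintro a b ⟨σ, hσ, ha⟩ ⟨τ, hτ, hb⟩
    exact ⟨σ * τ, mul_mem hσ hτ, fun x => by
      rw [AffineIsometryEquiv.coe_mul, Function.comp_apply, ha, hb]; rfl⟩
  inv_mem' := by
    rintro a ⟨σ, hσ, ha⟩
    refine ⟨σ⁻¹, inv_mem hσ, fun x => ?_⟩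
    apply σ.injective
    rw [← ha]
    change ((a (a.symm x) : E') : P) = σ (σ.symm x)
    simp

theorem mem_restrictedGroup {Γ : Subgroup (P ≃ᵃⁱ[ℝ] P)} {E' : AffineSubspace ℝ P} [Nonempty E']
    {g : E' ≃ᵃⁱ[ℝ] E'} : g ∈ restrictedGroup Γ E' ↔
      ∃ σ ∈ stabilizerIn Γ (E' : Set P), ∀ x : E', (g x : P) = σ x := Iff.rfl

theorem exists_restriction {E' : AffineSubspace ℝ P} [Nonempty E'] {σ : P ≃ᵃⁱ[ℝ] P}
    (hσ : σ '' (E' : Set P) = E') : ∃ g : E' ≃ᵃⁱ[ℝ] E', ∀ x : E', (g x : P) = σ x := by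
  have h : E'.map σ.toAffineIsometry.toAffineMap = E' := by
    apply SetLike.coe_injective
    rw [AffineSubspace.coe_map]
    exact hσ
  exact ⟨(E'.isometryEquivMap σ.toAffineIsometry).trans (AffineIsometryEquiv.ofEq _ _ h),
    fun x => rfl⟩

theorem exists_mem_restrictedGroup {Γ : Subgroup (P ≃ᵃⁱ[ℝ] P)} {E' : AffineSubspace ℝ P}
    [Nonempty E'] {σ : P ≃ᵃⁱ[ℝ] P} (hσ : σ ∈ stabilizerIn Γ (E' : Set P)) :
    ∃ g ∈ restrictedGroup Γ E', ∀ x : E', (g x : P) = σ x := by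
  obtain ⟨g, hg⟩ := exists_restriction hσ.2
  exact ⟨g, ⟨σ, hσ, hg⟩, hg⟩

/-- An isometry preserving a direction maps parallel affine subspaces onto each other as soon as it
does so for one point. -/
theorem image_eq_of_apply_mem {Γ : Subgroup (P ≃ᵃⁱ[ℝ] P)} {W : Submodule ℝ V}
    (hW : IsLinearInvariant Γ W) {γ : P ≃ᵃⁱ[ℝ] P} (hγ : γ ∈ Γ) {E₁ E₂ : AffineSubspace ℝ P}
    (h₁ : E₁.direction = W) (h₂ : E₂.direction = W) {x : P} (hx : x ∈ E₁) (hγx : γ x ∈ E₂) :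
    γ '' (E₁ : Set P) = E₂ := by
  have hlin : ∀ v : V, γ (v +ᵥ x) = linearPart γ v +ᵥ γ x := fun v => γ.map_vadd x v
  ext z
  constructor
  · rintro ⟨y, hy, rfl⟩
    rw [← vsub_vadd y x, hlin]
    refine AffineSubspace.vadd_mem_of_mem_direction ?_ hγx
    rw [h₂]
    exact hW γ hγ _ (h₁ ▸ AffineSubspace.vsub_mem_direction hy hx)
  · intro hz
    obtain ⟨v, hv, hvz⟩ := hW.exists_apply_eq hγ
      (h₂ ▸ AffineSubspace.vsub_mem_direction hz hγx : z -ᵥ γ x ∈ W)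
    refine ⟨v +ᵥ x, AffineSubspace.vadd_mem_of_mem_direction (h₁ ▸ hv) hx, ?_⟩
    rw [hlin, hvz, vsub_vadd]

theorem mem_stabilizerIn_of_apply_mem {Γ : Subgroup (P ≃ᵃⁱ[ℝ] P)} {E' : AffineSubspace ℝ P}
    (hW : IsLinearInvariant Γ E'.direction) {γ : P ≃ᵃⁱ[ℝ] P} (hγ : γ ∈ Γ) {x : P} (hx : x ∈ E')
    (hγx : γ x ∈ E') : γ ∈ stabilizerIn Γ (E' : Set P) :=
  ⟨hγ, image_eq_of_apply_mem hW hγ rfl rfl hx hγx⟩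

/-- Evaluation at `x` is continuous, and multiplication by `γ⁻¹` reduces isolating `γ` to isolating
the identity. -/
theorem discreteTopology_of_displacement {Γ : Subgroup (P ≃ᵃⁱ[ℝ] P)} {x : P} {ε : ℝ} (hε : 0 < ε)
    (h : ∀ γ ∈ Γ, dist (γ x) x < ε → γ = 1) : DiscreteTopology Γ := by
  rw [discreteTopology_iff_isOpen_singleton]
  intro γ
  have hc : Continuous fun g : Γ => (g : P ≃ᵃⁱ[ℝ] P) x := by
    have h1 : Continuous fun g : P ≃ᵃⁱ[ℝ] P => (g : P → P) := continuous_induced_dom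
    exact (continuous_apply x).comp (h1.comp continuous_subtype_val)
  convert! (Metric.isOpen_ball (x := (γ : P ≃ᵃⁱ[ℝ] P) x) (ε := ε)).preimage hc using 1
  ext g
  constructor
  · rintro rfl
    simpa using hε
  · intro hg
    have h1 : (γ : P ≃ᵃⁱ[ℝ] P)⁻¹ * g = 1 := by
      refine h _ (mul_mem (inv_mem γ.2) g.2) ?_
      rw [← (γ : P ≃ᵃⁱ[ℝ] P).dist_map]
      change dist ((γ : P ≃ᵃⁱ[ℝ] P) ((γ : P ≃ᵃⁱ[ℝ] P).symm ((g : P ≃ᵃⁱ[ℝ] P) x))) _ < ε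
      simpa using hg
    exact Subtype.ext (inv_mul_eq_one.1 h1).symm

/-! ### Freeness of discrete torsion-free groups -/

section Free

variable [FiniteDimensional ℝ V] (Γ : Subgroup (P ≃ᵃⁱ[ℝ] P)) [IsTorsionFreeDiscrete Γ]

/-- Discreteness alone only separates elements by their values on a finite set; a single point
suffices because the action is free and properly discontinuous. -/
theorem exists_displacement (x : P) : ∃ ε > 0, ∀ γ ∈ Γ, dist (γ x) x < ε → γ = 1 := by
  obtain ⟨U, hU, hΓ⟩ := (isQuotientCoveringMap_quotientMk_of_properlyDiscontinuousSMul
    (E := P) (G := Γ)).disjoint x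
  obtain ⟨ε, hε, hεU⟩ := Metric.mem_nhds_iff.1 hU
  exact ⟨ε, hε, fun γ hγ hd =>
    congrArg Subtype.val (hΓ ⟨γ, hγ⟩ ⟨γ x, ⟨x, mem_of_mem_nhds hU, rfl⟩, hεU hd⟩)⟩

variable {Γ}

theorem eq_one_of_apply_eq {γ : P ≃ᵃⁱ[ℝ] P} (hγ : γ ∈ Γ) {x : P} (hx : γ x = x) : γ = 1 := by
  obtain ⟨ε, hε, h⟩ := exists_displacement Γ x
  exact h γ hγ (by rwa [hx, dist_self])

theorem eq_of_apply_eq {γ δ : P ≃ᵃⁱ[ℝ] P} (hγ : γ ∈ Γ) (hδ : δ ∈ Γ) {x : P} (hx : γ x = δ x) :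
    γ = δ := by
  have h : δ⁻¹ * γ = 1 := eq_one_of_apply_eq (mul_mem (inv_mem hδ) hγ) (x := x) (by
    change δ.symm (γ x) = x
    rw [hx, δ.symm_apply_apply])
  exact (inv_mul_eq_one.1 h).symm

/-- Both properties come from `Γ` through one point of `E'`: a small displacement there forces `σ =
1`, and if `g ^ n = 1` then `σ ^ n` fixes the point, so that `σ` has finite order. -/
instance isTorsionFreeDiscrete_restrictedGroup (E' : AffineSubspace ℝ P) [Nonempty E'] :
    IsTorsionFreeDiscrete (restrictedGroup Γ E') where
  discrete := by
    obtain ⟨x⟩ : Nonempty E' := inferInstance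
    obtain ⟨ε, hε, h⟩ := exists_displacement Γ (x : P)
    refine discreteTopology_of_displacement (x := x) hε ?_
    rintro g ⟨σ, hσ, hg⟩ hd
    have h1 : σ = 1 := h σ hσ.1 (by rw [← hg]; exact hd)
    ext y
    rw [hg, h1]
    rfl
  torsionFree := by
    rintro g ⟨σ, hσ, hg⟩ hfin
    obtain ⟨x⟩ : Nonempty E' := inferInstance
    obtain ⟨n, hn, hgn⟩ := isOfFinOrder_iff_pow_eq_one.1 hfin
    have hpow : ∀ (k : ℕ) (y : E'), ((g ^ k) y : P) = (σ ^ k) y := fun k => by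
      induction k with
      | zero => exact fun y => rfl
      | succ k ih =>
        intro y
        rw [pow_succ, pow_succ]
        exact (ih (g y)).trans (congrArg (σ ^ k) (hg y))
    have h1 : σ ^ n = 1 := eq_one_of_apply_eq (pow_mem hσ.1 n) (x := (x : P)) (by
      rw [← hpow, hgn]; rfl)
    have h2 : σ = 1 := IsTorsionFreeDiscrete.torsionFree (Γ := Γ) σ hσ.1
      (isOfFinOrder_iff_pow_eq_one.2 ⟨n, hn, h1⟩)
    ext y
    rw [hg, h2]
    rfl

/-- A group of isometries whose orbits lie in those of a discrete torsion-free group is contained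
in this group. -/
theorem le_of_orbits_subset {Γ' : Subgroup (P ≃ᵃⁱ[ℝ] P)}
    (h : ∀ g ∈ Γ', ∀ x, ∃ γ ∈ Γ, γ x = g x) : Γ' ≤ Γ := by
  intro g hg
  have o : P := Classical.arbitrary P
  obtain ⟨γ, hγ, hγo⟩ := h g hg o
  have hpc : PreconnectedSpace P :=
    (Homeomorph.vaddConst o : V ≃ₜ P).surjective.denseRange.preconnectedSpace
      (Homeomorph.vaddConst o : V ≃ₜ P).continuous
  -- For openness, let `δ ∈ Γ` agree with `g` at a point `y` near `x`. Then `δ x` is within `2 *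
  -- dist x y < ε` of `g x = γ x`, which forces `δ = γ`.
  have hS : IsClopen {x | g x = γ x} := by
    refine ⟨isClosed_eq g.continuous γ.continuous, isOpen_iff_mem_nhds.2 fun x hx => ?_⟩
    obtain ⟨ε, hε, hΓ⟩ := exists_displacement Γ x
    filter_upwards [Metric.ball_mem_nhds x (half_pos hε)] with y hy
    obtain ⟨δ, hδ, hδy⟩ := h g hg y
    have h1 : γ⁻¹ * δ = 1 := by
      refine hΓ _ (mul_mem (inv_mem hγ) hδ) ?_
      change dist (γ.symm (δ x)) x < ε
      rw [← γ.dist_map, γ.apply_symm_apply, ← show g x = γ x from hx]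
      have h2 := dist_triangle (δ x) (δ y) (g x)
      rw [δ.dist_map, hδy, g.dist_map, dist_comm x y] at h2
      rw [Metric.mem_ball] at hy
      linarith
    rw [inv_mul_eq_one] at h1
    change g y = γ y
    rw [← hδy, h1]
  have h1 := hS.eq_univ ⟨o, hγo.symm⟩
  have h2 : g = γ := by
    ext x
    exact h1.symm.le (mem_univ x)
  exact h2 ▸ hγ

end Free

end RestrictedGroup

/-! ## Change of the model space -/

section TransModel

variable {W E Q : Type*} [NormedAddCommGroup W] [NormedSpace ℝ W] [NormedAddCommGroup E]
  [NormedSpace ℝ E] [TopologicalSpace Q] [ChartedSpace W Q]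

variable (Q) in
/-- The charts of a manifold, followed by an isomorphism of the model space. -/
abbrev chartedSpaceTransModel (A : W ≃L[ℝ] E) : ChartedSpace E Q where
  atlas := (fun e => e.transHomeomorph A.toHomeomorph) '' atlas W Q
  chartAt x := (chartAt W x).transHomeomorph A.toHomeomorph
  mem_chart_source x := mem_chart_source W x
  chart_mem_atlas x := ⟨_, chart_mem_atlas W x, rfl⟩

/-- `Submanifold` asks for charts in a standard Euclidean space, whereas quotients of `E'` have
charts in the direction of `E'`. -/
theorem isManifold_transModel [IsManifold 𝓘(ℝ, W) ∞ Q] (A : W ≃L[ℝ] E) :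
    letI := chartedSpaceTransModel Q A
    IsManifold 𝓘(ℝ, E) ∞ Q := by
  let := chartedSpaceTransModel Q A
  refine isManifold_of_contDiffOn _ _ _ ?_
  rintro _ _ ⟨e, he, rfl⟩ ⟨e', he', rfl⟩
  have h1 : ContMDiffOn 𝓘(ℝ, W) 𝓘(ℝ, W) ∞ (e' ∘ e.symm) (e.symm ≫ₕ e').source :=
    (contMDiffOn_of_mem_maximalAtlas (IsManifold.subset_maximalAtlas he')).comp
      ((contMDiffOn_symm_of_mem_maximalAtlas (IsManifold.subset_maximalAtlas he)).mono
        fun x hx => hx.1) fun x hx => hx.2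
  have h2 := A.contDiff.comp_contDiffOn ((contMDiffOn_iff_contDiffOn.1 h1).comp
    A.symm.contDiff.contDiffOn (mapsTo_preimage A.symm _))
  refine ContDiffOn.congr_mono h2 (fun x _ => rfl) fun x hx => ?_
  exact hx.1

theorem isLocalDiffeomorph_id_transModel [IsManifold 𝓘(ℝ, W) ∞ Q] (A : W ≃L[ℝ] E) :
    letI := chartedSpaceTransModel Q A
    IsLocalDiffeomorph 𝓘(ℝ, W) 𝓘(ℝ, E) ∞ (id : Q → Q) := by
  let := chartedSpaceTransModel Q A
  have := isManifold_transModel (Q := Q) A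
  intro q
  let A' : Diffeomorph 𝓘(ℝ, W) 𝓘(ℝ, E) W E ∞ :=
    ⟨A.toEquiv, A.contDiff.contMDiff, A.symm.contDiff.contMDiff⟩
  have h1 := IsManifold.chart_mem_maximalAtlas (I := 𝓘(ℝ, W)) (n := ∞) q
  have h2 := IsManifold.chart_mem_maximalAtlas (I := 𝓘(ℝ, E)) (n := ∞) q
  refine ⟨((partialDiffeomorphOfMemMaximalAtlas h1).trans A'.toPartialDiffeomorph).trans
    (partialDiffeomorphOfMemMaximalAtlas h2).symm, ?_, ?_⟩
  · refine ⟨⟨mem_chart_source W q, trivial⟩, ?_⟩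
    exact (chartAt E q).map_source (mem_chart_source E q)
  · rintro y ⟨⟨hy, -⟩, -⟩
    exact ((chartAt E q).left_inv (show y ∈ (chartAt E q).source from hy)).symm

end TransModel

/-! ## Leaves -/

section Cosets

variable {V : Type v} {P M : Type u} [NormedAddCommGroup V] [InnerProductSpace ℝ V]
  [FiniteDimensional ℝ V] [MetricSpace P] [NormedAddTorsor V P] [TopologicalSpace M]
  [ChartedSpace V M] {Γ : Subgroup (P ≃ᵃⁱ[ℝ] P)} {pr : P → M} (h : IsFlatProjection Γ pr)
  {W : Submodule ℝ V} (hW : IsLinearInvariant Γ W)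

omit [FiniteDimensional ℝ V] in
theorem exists_isCoset (W : Submodule ℝ V) (x : P) :
    ∃ E' : AffineSubspace ℝ P, IsCoset W E' ∧ x ∈ E' :=
  ⟨AffineSubspace.mk' x W, ⟨⟨x, AffineSubspace.self_mem_mk' x W⟩, AffineSubspace.direction_mk' x W⟩,
    AffineSubspace.self_mem_mk' x W⟩

include h hW

namespace IsFlatProjection

-- An element of `Γ` relating a point of `E₁` to one of `E₂` maps `E₁` onto `E₂`, by invariance of
-- `W`. Images of cosets are therefore equal or disjoint.
omit [FiniteDimensional ℝ V] in
theorem image_eq_image_of_mem {E₁ E₂ : AffineSubspace ℝ P} (h₁ : IsCoset W E₁)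
    (h₂ : IsCoset W E₂) {m : M} (hm₁ : m ∈ pr '' E₁) (hm₂ : m ∈ pr '' E₂) :
    pr '' (E₁ : Set P) = pr '' E₂ := by
  obtain ⟨x, hx, rfl⟩ := hm₁
  obtain ⟨y, hy, hxy⟩ := hm₂
  obtain ⟨γ, hγ, rfl⟩ := h.apply_eq_apply_iff.1 hxy.symm
  rw [← image_eq_of_apply_mem hW hγ h₁.2 h₂.2 hx hy, image_image]
  exact image_congr fun z _ => (h.apply_smul hγ z).symm

variable [IsManifold 𝓘(ℝ, V) ∞ M]

theorem eventually_incl_mem (N : Submanifold V M) (hN : N.IsIntegral (parallelField M W))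
    {E' : AffineSubspace ℝ P} (hE' : IsCoset W E') {p : N.Pts} (hp : N.incl p ∈ pr '' E') :
    ∀ᶠ q in 𝓝 p, N.incl q ∈ pr '' E' := by
  obtain ⟨x, hx, hxp⟩ := hp
  obtain rfl := hE'.2
  have : Nonempty E' := ⟨⟨x, hx⟩⟩
  obtain ⟨Φ, hxΦ, hΦ⟩ := h.exists_partialDiffeomorph hW N hN p ⟨x, hx⟩ hxp.symm
  have h1 : Φ ⟨x, hx⟩ = p := N.incl_injective ((hΦ _ hxΦ).trans hxp)
  filter_upwards [Φ.open_target.mem_nhds (h1 ▸ Φ.map_source hxΦ)] with q hq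
  have h2 := hΦ _ (Φ.map_target hq)
  refine ⟨_, Subtype.coe_prop (Φ.symm q), h2.symm.trans ?_⟩
  exact congrArg N.incl (Φ.right_inv hq)

theorem range_incl_subset (N : Submanifold V M) (hN : N.IsIntegral (parallelField M W))
    (hc : ConnectedSpace N.Pts) {E' : AffineSubspace ℝ P} (hE' : IsCoset W E') {p : N.Pts}
    (hp : N.incl p ∈ pr '' E') : range N.incl ⊆ pr '' E' := by
  -- Points outside this set lie over the image of another coset. That condition is open too, and
  -- the two images are disjoint.
  have hS : IsClopen {q | N.incl q ∈ pr '' E'} := by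
    refine ⟨⟨isOpen_iff_mem_nhds.2 fun q hq => ?_⟩, isOpen_iff_mem_nhds.2 fun q hq =>
      h.eventually_incl_mem hW N hN hE' hq⟩
    obtain ⟨z, hz⟩ := h.surjective (N.incl q)
    obtain ⟨E₂, hE₂, hzE₂⟩ := exists_isCoset W z
    have h1 : N.incl q ∈ pr '' E₂ := ⟨z, hzE₂, hz⟩
    filter_upwards [h.eventually_incl_mem hW N hN hE₂ h1] with r hr hr'
    exact hq (h.image_eq_image_of_mem hW hE' hE₂ hr' hr ▸ h1)
  rintro _ ⟨q, rfl⟩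
  exact (hS.eq_univ ⟨p, hp⟩).symm.le (mem_univ q)

end IsFlatProjection

end Cosets

/-! ### Images of affine subspaces as integral manifolds -/

section LeafSubmanifold

variable {V : Type v} {P M : Type u} [NormedAddCommGroup V] [InnerProductSpace ℝ V]
  [FiniteDimensional ℝ V] [MetricSpace P] [NormedAddTorsor V P] [TopologicalSpace M]
  [ChartedSpace V M] [IsManifold 𝓘(ℝ, V) ∞ M]
  {Γ : Subgroup (P ≃ᵃⁱ[ℝ] P)} {pr : P → M} (h : IsFlatProjection Γ pr)
  {E' : AffineSubspace ℝ P} [Nonempty E'] (hW : IsLinearInvariant Γ E'.direction)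

omit [FiniteDimensional ℝ V] in
theorem hasMFDerivAt_coe (x : E') :
    HasMFDerivAt 𝓘(ℝ, E'.direction) 𝓘(ℝ, V) (fun y : E' => (y : P)) x E'.direction.subtypeL :=
  hasMFDerivAt_of_map_vadd _ (fun _ _ => rfl) x

include h in
omit [FiniteDimensional ℝ V] in
/-- The differential of a lift of the projection to a submanifold. -/
theorem IsFlatProjection.dincl_mfderiv (N : Submanifold V M) {q : E' → N.Pts}
    (hq : ∀ x : E', N.incl (q x) = pr x) {x : E'}
    (hqx : MDifferentiableAt 𝓘(ℝ, E'.direction) (𝓡 N.dim) q x) :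
    ∃ γ ∈ Γ, ∀ v : E'.direction,
      N.dincl (q x) (mfderiv 𝓘(ℝ, E'.direction) (𝓡 N.dim) q x v) = linearPart γ (v : V) := by
  obtain ⟨γ, hγ, hd⟩ := h.exists_mfderiv_eq (x : P)
  refine ⟨γ, hγ, fun v => ?_⟩
  have h1 := (N.mdifferentiableAt_incl (q x)).hasMFDerivAt.comp x hqx.hasMFDerivAt
  have h2 := (h.mdifferentiableAt (x : P)).hasMFDerivAt.comp x (hasMFDerivAt_coe x)
  have h3 : N.incl ∘ q = pr ∘ fun y : E' => (y : P) := funext hq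
  rw [h3] at h1
  have h4 := congrArg (fun A : E'.direction →L[ℝ] V => A v) (hasMFDerivAt_unique h1 h2)
  exact h4.trans (hd v)

-- An element of `Γ` moving some point of `E'` into `E'` stabilizes `E'`. Injectivity of leaf
-- inclusions, the covering property and the uniqueness of `Γ'` all rest on this.
include h hW in
omit [IsManifold 𝓘(ℝ, V) ∞ M] in
theorem IsFlatProjection.lift_apply_eq_iff [IsTorsionFreeDiscrete Γ] {x y : E'} :
    quotientMap (restrictedGroup Γ E') x = quotientMap (restrictedGroup Γ E') y ↔
      pr x = pr y := by
  rw [(isFlatProjection_quotientMap (restrictedGroup Γ E')).apply_eq_apply_iff,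
    h.apply_eq_apply_iff]
  constructor
  · rintro ⟨g, ⟨σ, hσ, hg⟩, rfl⟩
    exact ⟨σ, hσ.1, (hg x).symm⟩
  · rintro ⟨γ, hγ, hxy⟩
    obtain ⟨g, hg, hgγ⟩ := exists_mem_restrictedGroup
      (mem_stabilizerIn_of_apply_mem hW hγ x.2 (by rw [hxy]; exact y.2))
    exact ⟨g, hg, Subtype.ext ((hgγ x).trans hxy)⟩

include h hW in
/-- The projection of an affine subspace whose direction is invariant, as a submanifold. -/
theorem IsFlatProjection.exists_submanifold [IsTorsionFreeDiscrete Γ] :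
    ∃ N : Submanifold V M, ConnectedSpace N.Pts ∧
      N.IsIntegral (parallelField M E'.direction) ∧ range N.incl = pr '' E' := by
  set Γ' := restrictedGroup Γ E'
  have hΓ' := isFlatProjection_quotientMap Γ'
  let E := EuclideanSpace ℝ (Fin (Module.finrank ℝ E'.direction))
  let A : E'.direction ≃L[ℝ] E :=
    (stdOrthonormalBasis ℝ E'.direction).repr.toContinuousLinearEquiv
  let : ChartedSpace E (QuotientSpace Γ') := chartedSpaceTransModel (QuotientSpace Γ') A
  have hman : IsManifold 𝓘(ℝ, E) ∞ (QuotientSpace Γ') := isManifold_transModel A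
  have hql : IsLocalDiffeomorph 𝓘(ℝ, E'.direction) 𝓘(ℝ, E) ∞ (quotientMap Γ') := fun x =>
    (hΓ'.isLocalDiffeomorph x).comp _ _ (isLocalDiffeomorph_id_transModel A _)
  let incl : QuotientSpace Γ' → M := Quotient.lift (fun x : E' => pr x) fun x y hxy =>
    (h.lift_apply_eq_iff hW).1 (Quotient.sound hxy)
  have hincl : ∀ x : E', incl (quotientMap Γ' x) = pr x := fun x => rfl
  have hinj : Function.Injective incl := by
    intro a b hab
    obtain ⟨x, rfl⟩ := hΓ'.surjective a
    obtain ⟨y, rfl⟩ := hΓ'.surjective b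
    exact (h.lift_apply_eq_iff hW).2 hab
  let o : E' := Classical.arbitrary E'
  have hsc : SecondCountableTopology E' :=
    (Homeomorph.vaddConst o : E'.direction ≃ₜ E').symm.secondCountableTopology
  have hconn : ConnectedSpace E' :=
    (Homeomorph.vaddConst o : E'.direction ≃ₜ E').surjective.connectedSpace
      (Homeomorph.vaddConst o : E'.direction ≃ₜ E').continuous
  have himm : IsImmersion 𝓘(ℝ, E) 𝓘(ℝ, V) ∞ incl := by
    have hcinc : Continuous incl :=
      hΓ'.isQuotientMap.continuous_iff.2 (h.continuous.comp continuous_subtype_val)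
    let B : (E × E'.directionᗮ) ≃L[ℝ] V :=
      (A.symm.prodCongr (ContinuousLinearEquiv.refl ℝ E'.directionᗮ)).trans
        (Submodule.prodEquivOfIsCompl E'.direction E'.directionᗮ
          (Submodule.isCompl_orthogonal _)).toContinuousLinearEquiv
    have hB : ∀ t : E, B (t, 0) = (A.symm t : V) := fun t => by simp [B]
    let A' : Diffeomorph 𝓘(ℝ, E'.direction) 𝓘(ℝ, E) E'.direction E ∞ :=
      ⟨A.toEquiv, A.contDiff.contMDiff, A.symm.contDiff.contMDiff⟩
    -- In charts built from local inverses of the two projections, `incl` becomes the inclusion of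
    -- `E'` in `P`, with the orthogonal complement of the direction as the missing factor.
    refine ⟨E'.directionᗮ, inferInstance, inferInstance, fun q => ?_⟩
    obtain ⟨x, rfl⟩ := hΓ'.surjective q
    obtain ⟨Φ, hxΦ, hΦ⟩ := hql x
    obtain ⟨Ψ, hxΨ, hΨ⟩ := h.isLocalDiffeomorph (x : P)
    let dom := ((Φ.restrOpen _ (Ψ.open_source.preimage continuous_subtype_val)).symm.trans
      (vaddConstDiffeomorph x).symm.toPartialDiffeomorph).trans A'.toPartialDiffeomorph
    let cod := Ψ.symm.trans (vaddConstDiffeomorph (x : P)).symm.toPartialDiffeomorph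
    refine IsImmersionAtOfComplement.mk_of_continuousAt hcinc.continuousAt B
      dom.toOpenPartialHomeomorph cod.toOpenPartialHomeomorph ?_ ?_
      (OpenPartialHomeomorph.mem_maximalAtlas_of_contMDiffOn _ dom.contMDiffOn_toFun
        dom.contMDiffOn_invFun)
      (OpenPartialHomeomorph.mem_maximalAtlas_of_contMDiffOn _ cod.contMDiffOn_toFun
        cod.contMDiffOn_invFun) ?_
    · refine ⟨⟨?_, trivial⟩, trivial⟩
      rw [hΦ hxΦ]
      exact (Φ.restrOpen _ (Ψ.open_source.preimage continuous_subtype_val)).map_source ⟨hxΦ, hxΨ⟩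
    · refine ⟨?_, trivial⟩
      rw [hincl, hΨ hxΨ]
      exact Ψ.map_source hxΨ
    · intro t ht
      have ht' : t ∈ dom.target := by simpa [OpenPartialHomeomorph.extend] using ht
      have hy : (A.symm t +ᵥ x : E') ∈ Φ.source ∧ ((A.symm t +ᵥ x : E') : P) ∈ Ψ.source :=
        ht'.2.2
      have h1 : incl (Φ (A.symm t +ᵥ x)) = Ψ ((A.symm t +ᵥ x : E') : P) := by
        rw [← hΦ hy.1, hincl, hΨ hy.2]
      change Ψ.symm (incl (Φ (A.symm t +ᵥ x))) -ᵥ (x : P) = B (t, 0)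
      rw [h1, hB]
      have h2 : Ψ.symm (Ψ ((A.symm t +ᵥ x : E') : P)) = _ := Ψ.left_inv hy.2
      rw [h2]
      exact vadd_vsub (A.symm t : V) (x : P)
  let N : Submanifold V M :=
    { Pts := QuotientSpace Γ'
      dim := Module.finrank ℝ E'.direction
      secondCountable := ContinuousConstSMul.secondCountableTopology
      incl := incl
      incl_injective := hinj
      incl_immersion := himm }
  refine ⟨N, hΓ'.surjective.connectedSpace hΓ'.continuous, ?_, ?_⟩
  · intro q
    obtain ⟨x, rfl⟩ := hΓ'.surjective q
    obtain ⟨γ, hγ, hd⟩ := h.dincl_mfderiv N (q := quotientMap Γ') hincl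
      (hql.mdifferentiable (by simp) x)
    have hsurj : Function.Surjective (mfderiv 𝓘(ℝ, E'.direction) 𝓘(ℝ, E) (quotientMap Γ') x) :=
      ((hql x).mfderivToContinuousLinearEquiv (by simp)).surjective
    ext w
    constructor
    · rintro ⟨t, rfl⟩
      obtain ⟨v, rfl⟩ := hsurj t
      exact (congrArg (· ∈ E'.direction) (hd v)).mpr (hW γ hγ _ (show E'.direction from v).2)
    · intro hw
      obtain ⟨v, hv, hvw⟩ := hW.exists_apply_eq hγ hw
      exact ⟨_, (hd ⟨v, hv⟩).trans hvw⟩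
  · ext m
    constructor
    · rintro ⟨q, rfl⟩
      obtain ⟨x, rfl⟩ := hΓ'.surjective q
      exact ⟨x, x.2, rfl⟩
    · rintro ⟨x, hx, rfl⟩
      exact ⟨quotientMap Γ' ⟨x, hx⟩, rfl⟩

end LeafSubmanifold

/-! ### Identification of the leaves, their coverings and geodesics -/

section Leaves

variable {V : Type v} {P M : Type u} [NormedAddCommGroup V] [InnerProductSpace ℝ V]
  [FiniteDimensional ℝ V] [MetricSpace P] [NormedAddTorsor V P] [TopologicalSpace M]
  [ChartedSpace V M] [IsManifold 𝓘(ℝ, V) ∞ M]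
  {Γ : Subgroup (P ≃ᵃⁱ[ℝ] P)} [IsTorsionFreeDiscrete Γ] {pr : P → M}
  (h : IsFlatProjection Γ pr)

namespace IsFlatProjection

section

variable {W : Submodule ℝ V} (hW : IsLinearInvariant Γ W)
include h hW

theorem exists_submanifold_of_isCoset {E' : AffineSubspace ℝ P} (hE' : IsCoset W E') :
    ∃ N : Submanifold V M, ConnectedSpace N.Pts ∧ N.IsIntegral (parallelField M W) ∧
      range N.incl = pr '' E' := by
  obtain rfl := hE'.2
  have : Nonempty E' := hE'.1.to_subtype
  exact h.exists_submanifold hW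

-- A larger connected integral manifold still meets `pr(E')`, and so is contained in it.
omit [IsTorsionFreeDiscrete Γ] in
theorem isLeaf_of_range_eq {N : Submanifold V M} (hc : ConnectedSpace N.Pts)
    (hN : N.IsIntegral (parallelField M W)) {E' : AffineSubspace ℝ P} (hE' : IsCoset W E')
    (hr : range N.incl = pr '' E') : N.IsLeaf (parallelField M W) := by
  refine ⟨hc, hN, fun N' hc' hN' hle => Subset.antisymm ?_ hle⟩
  obtain ⟨p⟩ := hc.toNonempty
  obtain ⟨p', hp'⟩ := hle ⟨p, rfl⟩
  rw [hr]
  exact h.range_incl_subset hW N' hN' hc' hE' (p := p') (by rw [hp', ← hr]; exact ⟨p, rfl⟩)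

/-- The leaf lies in the image of the coset through a lift of one of its points; maximality against
the submanifold with that image gives equality. -/
theorem exists_isCoset_of_isLeaf {N : Submanifold V M} (hN : N.IsLeaf (parallelField M W)) :
    ∃ E' : AffineSubspace ℝ P, IsCoset W E' ∧ range N.incl = pr '' E' := by
  obtain ⟨hc, hi, hmax⟩ := hN
  obtain ⟨p⟩ := hc.toNonempty
  obtain ⟨x, hx⟩ := h.surjective (N.incl p)
  obtain ⟨E', hE', hxE'⟩ := exists_isCoset W x
  obtain ⟨N', hc', hi', hr'⟩ := h.exists_submanifold_of_isCoset hW hE'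
  refine ⟨E', hE', ?_⟩
  rw [← hr']
  refine (hmax N' hc' hi' ?_).symm
  rw [hr']
  exact h.range_incl_subset hW N hi hc hE' ⟨x, hxE', hx⟩

theorem leafSets_eq : leafSets (parallelField M W) =
    {S | ∃ E' : AffineSubspace ℝ P, IsCoset W E' ∧ S = pr '' E'} := by
  ext S
  constructor
  · rintro ⟨N, hN, rfl⟩
    exact h.exists_isCoset_of_isLeaf hW hN
  · rintro ⟨E', hE', rfl⟩
    obtain ⟨N, hc, hi, hr⟩ := h.exists_submanifold_of_isCoset hW hE'
    exact ⟨N, h.isLeaf_of_range_eq hW hc hi hE' hr, hr⟩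

theorem isFoliation : IsFoliation (parallelField M W) := by
  intro m
  obtain ⟨x, rfl⟩ := h.surjective m
  obtain ⟨E', hE', hxE'⟩ := exists_isCoset W x
  rw [h.leafSets_eq hW]
  refine ⟨pr '' E', ⟨⟨E', hE', rfl⟩, x, hxE', rfl⟩, ?_⟩
  rintro _ ⟨⟨E₂, hE₂, rfl⟩, hx⟩
  exact h.image_eq_image_of_mem hW hE₂ hE' hx ⟨x, hxE', rfl⟩

end

section Lift

variable {E' : AffineSubspace ℝ P} [Nonempty E'] (hW : IsLinearInvariant Γ E'.direction)
  {N : Submanifold V M} (hN : N.IsIntegral (parallelField M E'.direction))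
include h hW hN

-- Not even continuity of `q` is assumed: as `incl` is injective, `q` must agree with the local
-- parametrizations of `N` by open parts of `E'`.
omit [IsTorsionFreeDiscrete Γ] in
theorem isLocalDiffeomorph_lift {q : E' → N.Pts} (hq : ∀ x : E', N.incl (q x) = pr x) :
    IsLocalDiffeomorph 𝓘(ℝ, E'.direction) (𝓡 N.dim) ∞ q := by
  intro x
  obtain ⟨Φ, hx, hΦ⟩ := h.exists_partialDiffeomorph hW N hN (q x) x (hq x)
  exact ⟨Φ, hx, fun y hy => N.incl_injective ((hq y).trans (hΦ y hy).symm)⟩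

theorem isRiemannianCoveringOnto_lift {q : E' → N.Pts} (hq : ∀ x : E', N.incl (q x) = pr x)
    (hs : Function.Surjective q) : IsRiemannianCoveringOnto (W := E'.direction) N q := by
  have hl := h.isLocalDiffeomorph_lift hW hN hq
  refine ⟨?_, hs, hl, fun x a b => ?_⟩
  · have hqm : IsQuotientMap q := hl.isOpenMap.isQuotientMap hl.contMDiff.continuous hs
    -- The fibres of `q` are the orbits of the restricted group, which acts freely and properly
    -- discontinuously.
    refine (hqm.isQuotientCoveringMap_of_properlyDiscontinuousSMul
      (G := restrictedGroup Γ E') ?_).isCoveringMap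
    intro x y
    rw [← N.incl_injective.eq_iff, hq, hq, ← h.lift_apply_eq_iff hW]
    exact Quotient.eq''
  · obtain ⟨γ, -, hd⟩ := h.dincl_mfderiv N hq (hl.mdifferentiable (by simp) x)
    exact (congrArg₂ (inner ℝ : V → V → ℝ) (hd a) (hd b)).trans
      (LinearIsometryEquiv.inner_map_map _ _ _)

omit h hN hW [FiniteDimensional ℝ V] [IsManifold 𝓘(ℝ, V) ∞ M] [IsTorsionFreeDiscrete Γ]
  [Nonempty E'] in
theorem exists_lift (hr : range N.incl = pr '' E') :
    ∃ q : E' → N.Pts, (∀ x : E', N.incl (q x) = pr x) ∧ Function.Surjective q := by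
  have h1 : ∀ x : E', ∃ p, N.incl p = pr x := fun x => by
    have : pr x ∈ range N.incl := hr ▸ ⟨x, x.2, rfl⟩
    exact this
  choose q hq using h1
  refine ⟨q, hq, fun p => ?_⟩
  obtain ⟨x, hx, hxp⟩ : N.incl p ∈ pr '' E' := hr ▸ ⟨p, rfl⟩
  exact ⟨⟨x, hx⟩, N.incl_injective ((hq _).trans hxp)⟩

theorem exists_covering (hr : range N.incl = pr '' E') :
    ∃ q : E' → N.Pts, (∀ x : E', N.incl (q x) = pr x) ∧
      IsRiemannianCoveringOnto (W := E'.direction) N q := by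
  obtain ⟨q, hq, hs⟩ := exists_lift hr
  exact ⟨q, hq, h.isRiemannianCoveringOnto_lift hW hN hq hs⟩

-- As `e ∘ pr` is an isometry `G` near `x`, a line in the chart with direction `G(w)`, `w` tangent
-- to `E'`, is the image of `t ↦ x + t w`. The latter stays in `E'`.
omit [IsTorsionFreeDiscrete Γ] in
theorem isTotallyGeodesic (hr : range N.incl = pr '' E') : N.IsTotallyGeodesic := by
  obtain ⟨q, hq, hs⟩ := exists_lift hr
  have hqc : Continuous q := (h.isLocalDiffeomorph_lift hW hN hq).contMDiff.continuous
  intro p e he hpe a ha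
  obtain ⟨x, rfl⟩ := hs p
  rw [hq] at hpe
  obtain ⟨G, hG⟩ := h.exists_isometry he hpe
  have h1 : a ∈ (parallelField M E'.direction).inChart e (pr x) := by
    rw [hN] at ha
    rw [← hq]
    exact ha
  rw [h.inChart_eq hW (mem_maximalAtlas_of_mem_flatCharts he) hpe hG] at h1
  obtain ⟨w, hw, rfl⟩ := h1
  let w' : E'.direction := ⟨w, hw⟩
  have hcl : Continuous fun t : ℝ => t • w' +ᵥ x := by fun_prop
  have hc : Continuous fun t : ℝ => q (t • w' +ᵥ x) := hqc.comp hcl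
  refine ⟨fun t => q (t • w' +ᵥ x), by simp, ?_⟩
  have h2 : Tendsto (fun t : ℝ => ((t • w' +ᵥ x : E') : P)) (𝓝 0) (𝓝 (x : P)) := by
    have := (continuous_subtype_val.comp hcl).tendsto 0
    simpa [Function.comp_def] using this
  filter_upwards [h2.eventually hG, h2.eventually
    (h.continuous.continuousAt.eventually (e.open_source.mem_nhds hpe))] with t ht1 ht2
  refine ⟨hc.continuousAt, ?_⟩
  rw [hq, hq, ← e.left_inv ht2, ht1, hG.self_of_nhds]
  congr 1
  have h3 := G.map_vadd (x : P) (t • w)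
  refine h3.trans ?_
  rw [vadd_eq_add, map_smul, add_comm]
  rfl

omit [IsTorsionFreeDiscrete Γ] in
theorem compactSpace_of_subset_image (hr : range N.incl = pr '' E') {K : Set E'}
    (hK : IsCompact K) (hKr : ∀ x : E', ∃ y ∈ K, pr y = pr x) : CompactSpace N.Pts := by
  obtain ⟨q, hq, hs⟩ := exists_lift hr
  have hqc : Continuous q := (h.isLocalDiffeomorph_lift hW hN hq).contMDiff.continuous
  suffices h1 : q '' K = univ from ⟨h1 ▸ hK.image hqc⟩
  refine eq_univ_of_forall fun p => ?_
  obtain ⟨x, rfl⟩ := hs p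
  obtain ⟨y, hy, hyx⟩ := hKr x
  exact ⟨y, hy, N.incl_injective (by rw [hq, hq, hyx])⟩

end Lift

end IsFlatProjection

end Leaves

/-! ## Lattice subspaces -/

section Lattice

variable {V : Type v} {P : Type u} [NormedAddCommGroup V] [InnerProductSpace ℝ V]
  [FiniteDimensional ℝ V] [MetricSpace P] [NormedAddTorsor V P]
  {Γ : Subgroup (P ≃ᵃⁱ[ℝ] P)}

/-- The translations along a lattice subspace have a compact fundamental domain in each of the
affine subspaces parallel to it. -/
theorem exists_isCompact_of_isLatticeSubspace (E' : AffineSubspace ℝ P) [Nonempty E']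
    (hL : IsLatticeSubspace (latticeSubgroup Γ) E'.direction) :
    ∃ K : Set E', IsCompact K ∧
      ∀ x : E', ∃ v : E'.direction, (v : V) ∈ latticeSubgroup Γ ∧ v +ᵥ x ∈ K := by
  set S : Set E'.direction := {v | (v : V) ∈ latticeSubgroup Γ}
  have hS : ⊤ ≤ Submodule.span ℝ S := by
    rw [← Submodule.map_le_map_iff_of_injective E'.direction.injective_subtype, Submodule.map_span,
      Submodule.map_subtype_top]
    refine hL.ge.trans (Submodule.span_mono ?_)
    rintro v ⟨hv, hv'⟩
    exact ⟨⟨v, hv'⟩, hv, rfl⟩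
  -- The basis consists of lattice vectors. Its integer span may be smaller than `L ∩ W`, with `W`
  -- the direction of `E'`, but it already has a bounded fundamental domain.
  let b := Module.Basis.ofSpan hS
  have hb : ∀ i, (b i : V) ∈ latticeSubgroup Γ := fun i =>
    Module.Basis.ofSpan_subset hS ⟨i, rfl⟩
  have : Finite ((linearIndepOn_empty ℝ id).extend (empty_subset S)) := inferInstance
  have : Fintype ((linearIndepOn_empty ℝ id).extend (empty_subset S)) := Fintype.ofFinite _
  obtain ⟨o⟩ : Nonempty E' := inferInstance
  have hbd := ZSpan.fundamentalDomain_isBounded b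
  refine ⟨(fun v : E'.direction => v +ᵥ o) '' closure (ZSpan.fundamentalDomain b),
    hbd.isCompact_closure.image (Homeomorph.vaddConst o).continuous, fun x => ?_⟩
  -- Subtracting the integer part of the coordinates of `x` relative to `o` leaves the fractional
  -- part.
  refine ⟨-(ZSpan.floor b (x -ᵥ o) : E'.direction), ?_, ZSpan.fract b (x -ᵥ o),
    subset_closure (ZSpan.fract_mem_fundamentalDomain b _), ?_⟩
  · rw [Submodule.coe_neg]
    refine neg_mem ?_
    have h1 : ∀ v ∈ Submodule.span ℤ (range b), (v : V) ∈ latticeSubgroup Γ := by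
      intro v hv
      induction hv using Submodule.span_induction with
      | mem v hv => obtain ⟨i, rfl⟩ := hv; exact hb i
      | zero => exact zero_mem _
      | add v w _ _ h1 h2 => exact add_mem h1 h2
      | smul n v _ h1 => exact zsmul_mem h1 n
    exact h1 _ (ZSpan.floor b (x -ᵥ o)).2
  · change ZSpan.fract b (x -ᵥ o) +ᵥ o = _
    rw [ZSpan.fract_apply, sub_eq_neg_add, add_vadd, vsub_vadd]

end Lattice

theorem Homeomorph.isCoveringMap {X Y : Type*} [TopologicalSpace X] [TopologicalSpace Y]
    (f : X ≃ₜ Y) : IsCoveringMap f := fun y =>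
  IsEvenlyCovered.to_isEvenlyCovered_preimage (I := Unit)
    ⟨inferInstance, univ, mem_univ y, isOpen_univ, isOpen_univ,
      (((Homeomorph.Set.univ X).trans f).trans (Homeomorph.Set.univ Y).symm).trans
        (Homeomorph.prodPUnit _).symm, fun _ => rfl⟩

/-! ## Bieberbach groups of leaves -/

section LeafGroups

variable {V : Type v} {P : Type u} [NormedAddCommGroup V] [InnerProductSpace ℝ V]
  [MetricSpace P] [NormedAddTorsor V P] {Γ : Subgroup (P ≃ᵃⁱ[ℝ] P)}

theorem latticeSubgroup_translationSubgroup :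
    latticeSubgroup (translationSubgroup Γ) = latticeSubgroup Γ := by
  ext v
  constructor
  · exact fun hv => translationSubgroup_le Γ hv
  · exact fun hv => ⟨v, hv, rfl⟩

theorem constVAdd_mem_restrictedGroup {E' : AffineSubspace ℝ P} [Nonempty E'] {v : E'.direction}
    (hv : (v : V) ∈ latticeSubgroup Γ) :
    AffineIsometryEquiv.constVAdd ℝ E' v ∈ restrictedGroup Γ E' := by
  refine ⟨AffineIsometryEquiv.constVAdd ℝ P (v : V), ⟨hv, ?_⟩, fun x => rfl⟩
  ext z
  constructor
  · rintro ⟨y, hy, rfl⟩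
    exact AffineSubspace.vadd_mem_of_mem_direction v.2 hy
  · intro hz
    refine ⟨-(v : V) +ᵥ z, AffineSubspace.vadd_mem_of_mem_direction (neg_mem v.2) hz, ?_⟩
    exact vadd_neg_vadd (v : V) z

theorem coe_linearPart_eq {E' : AffineSubspace ℝ P} [Nonempty E'] {g : E' ≃ᵃⁱ[ℝ] E'}
    {σ : P ≃ᵃⁱ[ℝ] P} (h : ∀ x : E', (g x : P) = σ x) (v : E'.direction) :
    (linearPart g v : V) = linearPart σ (v : V) := by
  obtain ⟨x⟩ : Nonempty E' := inferInstance
  have h1 : g (v +ᵥ x) = linearPart g v +ᵥ g x := g.map_vadd x v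
  have h2 : σ ((v : V) +ᵥ (x : P)) = linearPart σ (v : V) +ᵥ σ x := σ.map_vadd _ _
  have h3 : ((linearPart g v : V) +ᵥ (g x : P)) = linearPart σ (v : V) +ᵥ (g x : P) := by
    rw [h x]
    refine Eq.trans ?_ ((congrArg Subtype.val h1).symm.trans (h (v +ᵥ x)) |>.trans h2)
    rw [← h x]
    rfl
  exact vadd_right_cancel _ h3

variable [FiniteDimensional ℝ V] [IsTorsionFreeDiscrete Γ] {E' : AffineSubspace ℝ P} [Nonempty E']

omit [FiniteDimensional ℝ V] [IsTorsionFreeDiscrete Γ] in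
theorem mem_holonomyGroup_restrictedGroup {A : E'.direction ≃ₗᵢ[ℝ] E'.direction} :
    A ∈ holonomyGroup (restrictedGroup Γ E') ↔ ∃ σ ∈ stabilizerIn Γ (E' : Set P),
      ∀ v : E'.direction, (A v : V) = linearPart σ (v : V) := by
  constructor
  · rintro ⟨g, ⟨σ, hσ, hg⟩, rfl⟩
    exact ⟨σ, hσ, coe_linearPart_eq hg⟩
  · rintro ⟨σ, hσ, hA⟩
    obtain ⟨g, hg, hgσ⟩ := exists_mem_restrictedGroup hσ
    refine ⟨g, hg, ?_⟩
    ext v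
    rw [hA, coe_linearPart_eq hgσ]

/-- Restriction is an isomorphism of the stabilizer onto the restricted group. -/
theorem exists_restriction_mulEquiv :
    ∃ ρ : stabilizerIn Γ (E' : Set P) ≃* restrictedGroup Γ E',
      ∀ (σ : stabilizerIn Γ (E' : Set P)) (x : E'),
        (((ρ σ : E' ≃ᵃⁱ[ℝ] E') x : E') : P) = (σ : P ≃ᵃⁱ[ℝ] P) (x : P) := by
  have h1 : ∀ σ : stabilizerIn Γ (E' : Set P), ∃ g : restrictedGroup Γ E',
      ∀ x : E', (((g : E' ≃ᵃⁱ[ℝ] E') x : E') : P) = (σ : P ≃ᵃⁱ[ℝ] P) (x : P) := fun σ => by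
    obtain ⟨g, hg, hgσ⟩ := exists_mem_restrictedGroup σ.2
    exact ⟨⟨g, hg⟩, hgσ⟩
  choose ρ hρ using h1
  have hext : ∀ g g' : restrictedGroup Γ E', (∀ x : E', (((g : E' ≃ᵃⁱ[ℝ] E') x : E') : P) =
      (((g' : E' ≃ᵃⁱ[ℝ] E') x : E') : P)) → g = g' := fun g g' hg => by
    apply Subtype.ext
    ext x
    exact hg x
  let ρ' : stabilizerIn Γ (E' : Set P) →* restrictedGroup Γ E' := MonoidHom.mk' ρ fun σ τ => by
    refine hext _ _ fun x => ?_
    rw [hρ]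
    exact ((hρ σ _).trans (congrArg (σ : P ≃ᵃⁱ[ℝ] P) (hρ τ x))).symm
  refine ⟨MulEquiv.ofBijective ρ' ⟨fun σ τ hστ => ?_, fun g => ?_⟩, hρ⟩
  · obtain ⟨x⟩ : Nonempty E' := inferInstance
    -- Elements of `Γ` that agree at a single point of `E'` are equal, the action being free.
    refine Subtype.ext (eq_of_apply_eq σ.2.1 τ.2.1 (x := (x : P)) ?_)
    rw [← hρ, ← hρ]
    exact congrArg (fun g : restrictedGroup Γ E' => (((g : E' ≃ᵃⁱ[ℝ] E') x : E') : P)) hστ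
  · obtain ⟨σ, hσ, hg⟩ := g.2
    exact ⟨⟨σ, hσ⟩, hext _ _ fun x => (hρ _ x).trans (hg x).symm⟩

/-- The translations in `L` along `E'` belong to the restricted group and are already cocompact on
`E'`. -/
theorem isBieberbach_restrictedGroup
    (hL : IsLatticeSubspace (latticeSubgroup Γ) E'.direction) :
    IsBieberbach (restrictedGroup Γ E') where
  cocompact := by
    obtain ⟨K, hK, hKE⟩ := exists_isCompact_of_isLatticeSubspace E' hL
    refine ⟨K, hK, fun x => ?_⟩
    obtain ⟨v, hv, hvx⟩ := hKE x
    exact ⟨_, constVAdd_mem_restrictedGroup hv, hvx⟩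

theorem compactSpace_of_isLatticeSubspace {N : Submanifold V (QuotientSpace Γ)}
    (hW : IsLinearInvariant Γ E'.direction)
    (hL : IsLatticeSubspace (latticeSubgroup Γ) E'.direction)
    (hN : N.IsIntegral (parallelField _ E'.direction))
    (hr : range N.incl = quotientMap Γ '' E') : CompactSpace N.Pts := by
  have h := isFlatProjection_quotientMap Γ
  obtain ⟨K, hK, hKE⟩ := exists_isCompact_of_isLatticeSubspace E' hL
  refine h.compactSpace_of_subset_image hW hN hr hK fun x => ?_
  obtain ⟨v, hv, hvx⟩ := hKE x
  exact ⟨_, hvx, h.apply_smul hv (x : P)⟩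

/-- The covering of the leaf by `E'` has the orbits of the restricted group as fibres, so it
descends to a bijective local diffeomorphism. The metrics agree because both projections from `E'`
are locally isometric. -/
theorem correspondsTo_restrictedGroup {N : Submanifold V (QuotientSpace Γ)}
    (hW : IsLinearInvariant Γ E'.direction)
    (hL : IsLatticeSubspace (latticeSubgroup Γ) E'.direction)
    (hN : N.IsIntegral (parallelField _ E'.direction))
    (hr : range N.incl = quotientMap Γ '' E') : CorrespondsTo N E' (restrictedGroup Γ E') := by
  have h := isFlatProjection_quotientMap Γ
  have h' := isFlatProjection_quotientMap (restrictedGroup Γ E')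
  obtain ⟨q, hq, hqc⟩ := h.exists_covering hW hN hr
  obtain ⟨-, hqs, hql, hqm⟩ := hqc
  let φ : QuotientSpace (restrictedGroup Γ E') → N.Pts := Quotient.lift q fun x y hxy => by
    apply N.incl_injective
    rw [hq, hq]
    exact (h.lift_apply_eq_iff hW).1 (Quotient.sound hxy)
  have hφ : φ ∘ quotientMap (restrictedGroup Γ E') = q := rfl
  have hφl : IsLocalDiffeomorph 𝓘(ℝ, E'.direction) (𝓡 N.dim) ∞ φ :=
    h'.isLocalDiffeomorph.of_comp h'.surjective hql
  have hφi : Function.Injective φ := by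
    intro a b hab
    obtain ⟨x, rfl⟩ := h'.surjective a
    obtain ⟨y, rfl⟩ := h'.surjective b
    rw [h.lift_apply_eq_iff hW, ← hq, ← hq]
    exact congrArg N.incl hab
  have hφs : Function.Surjective φ := Function.Surjective.of_comp (g := quotientMap _) hqs
  refine ⟨isBieberbach_restrictedGroup hL, φ, ⟨⟨?_, hφs, hφl, fun p a b => ?_⟩, hφi⟩, hq⟩
  · exact (Equiv.toHomeomorphOfContinuousOpen (Equiv.ofBijective φ ⟨hφi, hφs⟩)
      hφl.contMDiff.continuous hφl.isOpenMap).isCoveringMap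
  · obtain ⟨x, rfl⟩ := h'.surjective p
    have hsurj : Function.Surjective (mfderiv 𝓘(ℝ, E'.direction) 𝓘(ℝ, E'.direction)
        (quotientMap (restrictedGroup Γ E')) x) :=
      ((h'.isLocalDiffeomorph x).mfderivToContinuousLinearEquiv (by simp)).surjective
    have hchain : ∀ t, mfderiv 𝓘(ℝ, E'.direction) (𝓡 N.dim) φ (quotientMap _ x)
        (mfderiv 𝓘(ℝ, E'.direction) 𝓘(ℝ, E'.direction) (quotientMap (restrictedGroup Γ E')) x t) =
        mfderiv 𝓘(ℝ, E'.direction) (𝓡 N.dim) q x t := fun t =>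
      (mfderiv_comp_apply x (hφl.mdifferentiable (by simp) _) (h'.mdifferentiableAt x) t).symm
    obtain ⟨s, rfl⟩ := hsurj a
    obtain ⟨t, rfl⟩ := hsurj b
    rw [hchain, hchain]
    exact (hqm x s t).trans (h'.flatInner_mfderiv x s t).symm

/-- Injectivity of `φ` and of the inclusion makes the orbits of `Γ'` equal to the fibres of the
projection on `E'`, which are also the orbits of the restricted group. Both groups being discrete
and torsion-free, equal orbits give inclusions both ways. -/
theorem CorrespondsTo.eq_restrictedGroup {N : Submanifold V (QuotientSpace Γ)}
    (hW : IsLinearInvariant Γ E'.direction) {Γ' : Subgroup (E' ≃ᵃⁱ[ℝ] E')}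
    (hΓ' : CorrespondsTo N E' Γ') : Γ' = restrictedGroup Γ E' := by
  have h := isFlatProjection_quotientMap Γ
  obtain ⟨hB, φ, ⟨-, hφi⟩, hφ⟩ := hΓ'
  have h' := isFlatProjection_quotientMap Γ'
  have h'' := isFlatProjection_quotientMap (restrictedGroup Γ E')
  have key : ∀ x y : E', quotientMap Γ' x = quotientMap Γ' y ↔
      quotientMap (restrictedGroup Γ E') x = quotientMap (restrictedGroup Γ E') y := fun x y => by
    rw [h.lift_apply_eq_iff hW, ← hφ, ← hφ, N.incl_injective.eq_iff, hφi.eq_iff]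
  refine le_antisymm (le_of_orbits_subset fun g hg x => ?_) (le_of_orbits_subset fun g hg x => ?_)
  · exact h''.apply_eq_apply_iff.1 ((key _ _).1 (h'.apply_smul hg x).symm)
  · exact h'.apply_eq_apply_iff.1 ((key _ _).2 (h''.apply_smul hg x).symm)

theorem leaf_properties {W : Submodule ℝ V} (hW : IsLinearInvariant Γ W)
    (hL : IsLatticeSubspace (latticeSubgroup Γ) W) {N : Submanifold V (QuotientSpace Γ)}
    (hN : N.IsLeaf (parallelField _ W)) : CompactSpace N.Pts ∧ N.IsTotallyGeodesic := by
  have h := isFlatProjection_quotientMap Γ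
  obtain ⟨E₁, hE₁, hr⟩ := h.exists_isCoset_of_isLeaf hW hN
  obtain rfl := hE₁.2
  have : Nonempty E₁ := hE₁.1.to_subtype
  exact ⟨compactSpace_of_isLatticeSubspace hW hL hN.2.1 hr, h.isTotallyGeodesic hW hN.2.1 hr⟩

end LeafGroups

/-! ### The theorem -/

theorem mainTheorem2 {V : Type*} {P : Type*} [NormedAddCommGroup V] [InnerProductSpace ℝ V]
    [FiniteDimensional ℝ V] [MetricSpace P] [NormedAddTorsor V P]
    (Γ : Subgroup (P ≃ᵃⁱ[ℝ] P)) [IsBieberbach Γ] (W : Submodule ℝ V)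
    (hW_bot : W ≠ ⊥) (hW_top : W ≠ ⊤)
    (hW_hol : IsInvariantSubspace (holonomyGroup Γ) W)
    (hW_lat : IsLatticeSubspace (latticeSubgroup Γ) W) :
    -- the foliation of `E` by the cosets of `W`, and the two covering projections
    IsFoliation (constField P W) ∧
    leafSets (constField P W) = {S | ∃ E' : AffineSubspace ℝ P, IsCoset W E' ∧ S = (E' : Set P)} ∧
    IsRiemannianCovering (V := V) (quotientMap Γ) ∧
    IsRiemannianCovering (V := V) (quotientMap (translationSubgroup Γ)) ∧
    -- the projected foliation of the torus `E / L`
    (∃ D : TangentField V (QuotientSpace (translationSubgroup Γ)),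
      (constField P W).IsProjectable (quotientMap (translationSubgroup Γ)) D ∧
      D.IsParallel ∧ IsFoliation D ∧
      (∀ N : Submanifold V (QuotientSpace (translationSubgroup Γ)), N.IsLeaf D →
        CompactSpace N.Pts ∧ N.IsTotallyGeodesic) ∧
      leafSets D = {S | ∃ E' : AffineSubspace ℝ P, IsCoset W E' ∧
        S = quotientMap (translationSubgroup Γ) '' E'} ∧
      ∀ (E' : AffineSubspace ℝ P) [Nonempty E'], IsCoset W E' →
        ∀ N : Submanifold V (QuotientSpace (translationSubgroup Γ)), N.IsLeaf D →
          range N.incl = quotientMap (translationSubgroup Γ) '' E' →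
          ∃ q : E' → N.Pts, (∀ x : E', N.incl (q x) = quotientMap (translationSubgroup Γ) (x : P)) ∧
            IsRiemannianCoveringOnto (W := E'.direction) N q) ∧
    -- the projected foliation of `M = E / Γ`
    ∃ D : TangentField V (QuotientSpace Γ),
      (constField P W).IsProjectable (quotientMap Γ) D ∧
      D.IsParallel ∧ IsFoliation D ∧
      (∀ N : Submanifold V (QuotientSpace Γ), N.IsLeaf D →
        CompactSpace N.Pts ∧ N.IsTotallyGeodesic) ∧
      leafSets D = {S | ∃ E' : AffineSubspace ℝ P, IsCoset W E' ∧ S = quotientMap Γ '' E'} ∧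
      ∀ (E' : AffineSubspace ℝ P) [Nonempty E'], IsCoset W E' →
        ∀ N : Submanifold V (QuotientSpace Γ), N.IsLeaf D →
          range N.incl = quotientMap Γ '' E' →
          (∃ q : E' → N.Pts, (∀ x : E', N.incl (q x) = quotientMap Γ (x : P)) ∧
            IsRiemannianCoveringOnto (W := E'.direction) N q) ∧
          -- the Bieberbach group of the leaf
          (∃ Γ' : Subgroup (E' ≃ᵃⁱ[ℝ] E'), CorrespondsTo N E' Γ') ∧
          ∀ Γ' : Subgroup (E' ≃ᵃⁱ[ℝ] E'), CorrespondsTo N E' Γ' →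
            (∀ g : E' ≃ᵃⁱ[ℝ] E',
              g ∈ Γ' ↔ ∃ σ ∈ stabilizerIn Γ (E' : Set P), ∀ x : E', (g x : P) = σ x) ∧
            (∀ A : E'.direction ≃ₗᵢ[ℝ] E'.direction,
              A ∈ holonomyGroup Γ' ↔ ∃ σ ∈ stabilizerIn Γ (E' : Set P),
                ∀ v : E'.direction, (A v : V) = linearPart σ (v : V)) ∧
            (∀ v : E'.direction,
              v ∈ latticeSubgroup Γ' ↔ AffineIsometryEquiv.constVAdd ℝ E' v ∈ Γ') ∧
            (∀ v : E'.direction, (v : V) ∈ latticeSubgroup Γ → v ∈ latticeSubgroup Γ') ∧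
            ∃ ρ : stabilizerIn Γ (E' : Set P) ≃* Γ',
              ∀ (σ : stabilizerIn Γ (E' : Set P)) (x : E'),
                (((ρ σ : E' ≃ᵃⁱ[ℝ] E') x : E') : P) = (σ : P ≃ᵃⁱ[ℝ] P) (x : P) := by

  have hΓ : IsLinearInvariant Γ W := fun γ hγ v hv => hW_hol _ ⟨γ, hγ, rfl⟩ v hv
  have hL' : IsLatticeSubspace (latticeSubgroup (translationSubgroup Γ)) W := by
    rwa [latticeSubgroup_translationSubgroup]
  have hΓL := hΓ.mono (translationSubgroup_le Γ)
  have hid : IsFlatProjection (⊥ : Subgroup (P ≃ᵃⁱ[ℝ] P)) (id : P → P) := isFlatProjection_id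
  have hbot : IsTorsionFreeDiscrete (⊥ : Subgroup (P ≃ᵃⁱ[ℝ] P)) :=
    IsTorsionFreeDiscrete.mono (Γ := Γ) inferInstance bot_le
  have h := isFlatProjection_quotientMap Γ
  have hT := isFlatProjection_quotientMap (translationSubgroup Γ)
  -- On all three spaces the distribution is `W` in the preferred charts; on `E` this is
  -- `constField` by definition.
  refine ⟨hid.isFoliation (hΓ.mono bot_le), ?_, isRiemannianCovering_quotientMap Γ,
    isRiemannianCovering_quotientMap _,
    ⟨parallelField _ W, hT.isProjectable hΓL, hT.isParallel hΓL, hT.isFoliation hΓL,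
      fun N hN => leaf_properties hΓL hL' hN, hT.leafSets_eq hΓL, ?_⟩,
    ⟨parallelField _ W, h.isProjectable hΓ, h.isParallel hΓ, h.isFoliation hΓ,
      fun N hN => leaf_properties hΓ hW_lat hN, h.leafSets_eq hΓ, ?_⟩⟩
  · refine (hid.leafSets_eq (hΓ.mono bot_le)).trans ?_
    simp only [image_id]
  · intro E' _ hE' N hN hr
    obtain rfl := hE'.2
    exact hT.exists_covering hΓL hN.2.1 hr
  · intro E' _ hE' N hN hr
    obtain rfl := hE'.2
    refine ⟨h.exists_covering hΓ hN.2.1 hr,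
      ⟨_, correspondsTo_restrictedGroup hΓ hW_lat hN.2.1 hr⟩, fun Γ' hΓ' => ?_⟩
    -- By uniqueness, an arbitrary corresponding group may be replaced by the restricted group, for
    -- which the descriptions hold by construction.
    obtain rfl := hΓ'.eq_restrictedGroup hΓ
    exact ⟨fun g => mem_restrictedGroup, fun A => mem_holonomyGroup_restrictedGroup,
      fun v => Iff.rfl, fun v hv => constVAdd_mem_restrictedGroup hv,
      exists_restriction_mulEquiv⟩
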